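/- **Conventions.** Rings are associative and need not have a unit. A right module $X$ over a ring $A$ is *firm* if the map $X\otimes_A A\to X$, $x\otimes a\mapsto xa$, is bijective; firm left modules are defined symmetrically. A ring $A$ is *firm* if $A\otimes_A A\to A$ is bijective, and an $A$–$B$-bimodule is *firm* if it is firm on both sides. $\mathrm{Mod}_A$ and ${}_A\mathrm{Mod}$ are the categories of firm right and firm left $A$-modules. $\mathbf{Firm}$ is the bicategory of firm rings, firm bimodules and bimodule homomorphisms, with composition given by the tensor product of bimodules and with identity 1-cells the bimodules $A$. A functor $F$ is *comonadic* if it has a right adjoint and the comparison functor to the category of coalgebras over the induced comonad is an equivalence. Let $A,B$ be firm rings and let $M$ be a firm $A$–$B$-bimodule with a right adjoint $M^\dagger$ (a firm $B$–$A$-bimodule) in $\mathbf{Firm}$, with unit $\eta:A\to M\otimes_B M^\dagger$ and counit $\varepsilon:M^\dagger\otimes_A M\to B$. Then: * $S_M=M\otimes_B M^\dagger$ is an $A$-ring (a monoid in the monoidal category of firm $A$–$A$-bimodules), with unit $\eta$ and multiplication $m=M\otimes\varepsilon\otimes M^\dagger$. * $\mathfrak C_M=M^\dagger\otimes_A M$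 is a $B$-coring (a comonoid in the monoidal category of firm $B$–$B$-bimodules), with counit $\varepsilon$ and comultiplication $M^\dagger\otimes\eta\otimes M$. $\mathrm{End}_{B\text{-cor}}(\mathfrak C_M)$ is the monoid of its coring endomorphisms under composition. * $\mathbf I^r_A(S_M)$ (resp. $\mathbf I^l_A(S_M)$) is the class of subobjects $[i:J\to S_M]$ of $S_M$ in the category of firm $A$–$A$-bimodules such that $m(i\otimes S_M):J\otimes_A S_M\to S_M$ (resp. $m(S_M\otimes i):S_M\otimes_A J\to S_M$) is an isomorphism. The product of $[i_1:J_1\to S_M]$ and $[i_2:J_2\to S_M]$ is $[m(i_1\otimes i_2):J_1\otimes_A J_2\to S_M]$, and the unit is $[\eta:A\to S_M]$, whenever these define a monoid structure (in particular, whenever these maps are monomorphisms of firm bimodules). * $M$ is *separable* if $\eta$ is a split monomorphism of $A$–$A$-bimodules. For $[i:J\to S_M]\in\mathbf I^r_A(S_M)$ put $\xi_i=(M\otimes\varepsilon)(i\otimes M):J\otimes_A M\to M$ and $$\Gamma_M([i])=(\varepsilon\otimes M^\dagger\otimes M)\,(M^\dagger\otimes i\otimes M)\,(M^\dagger\otimes\xi_i^{-1}):\mathfrak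 C_M\to\mathfrak C_M .$$ For $[i:J\to S_M]\in\mathbf I^l_A(S_M)$ put $\xi'_i=(\varepsilon\otimes M^\dagger)(M^\dagger\otimes i):M^\dagger\otimes_A J\to M^\dagger$ and $$\Gamma_{M^\dagger}([i])=(M^\dagger\otimes M\otimes\varepsilon)\,(M^\dagger\otimes i\otimes M)\,(\xi_i'^{-1}\otimes M):\mathfrak C_M\to\mathfrak C_M .$$ **Theorem.** (i) If $-\otimes_A M:\mathrm{Mod}_A\to\mathrm{Mod}_B$ is comonadic, then $\mathbf I^r_A(S_M)$ is a monoid under the above product, all $\xi_i$ are isomorphisms, and $\Gamma_M:\mathbf I^r_A(S_M)^{op}\to\mathrm{End}_{B\text{-cor}}(\mathfrak C_M)$ is a well-defined isomorphism of monoids. (ii) If $M^\dagger\otimes_A-:{}_A\mathrm{Mod}\to{}_B\mathrm{Mod}$ is comonadic, then $\mathbf I^l_A(S_M)$ is a monoid under the above product, all $\xi'_i$ are isomorphisms, and $\Gamma_{M^\dagger}:\mathbf I^l_A(S_M)\to\mathrm{End}_{B\text{-cor}}(\mathfrak C_M)$ is a well-defined isomorphism of monoids. (iii) If $M$ is separable,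 then all the conclusions of (i) and (ii) hold. -/

import Mathlib

open CategoryTheory

universe u w v u₁

namespace FirmBicat

open scoped TensorProduct

/-! ### Bimodules over rings that need not have a unit -/

/-- An `A`-`B`-bimodule over not necessarily unital rings: `lact a m` is `a m` and `ract b m`
is `m b`. -/
structure Bimodule (A B : Type u) [NonUnitalRing A] [NonUnitalRing B] where
  carrier : Type u
  [addCommGroup : AddCommGroup carrier]
  lact : A →+ carrier →+ carrier
  ract : B →+ carrier →+ carrier
  lact_mul : ∀ a a' m, lact (a * a') m = lact a (lact a' m)
  ract_mul : ∀ b b' m, ract (b * b') m = ract b' (ract b m)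
  lact_ract : ∀ a b m, lact a (ract b m) = ract b (lact a m)

attribute [instance] Bimodule.addCommGroup

namespace Bimodule

variable {A B C D : Type u} [NonUnitalRing A] [NonUnitalRing B] [NonUnitalRing C]
  [NonUnitalRing D]

/-- Homomorphisms of bimodules. -/
structure Hom (M N : Bimodule A B) where
  toHom : M.carrier →+ N.carrier
  map_lact : ∀ a m, toHom (M.lact a m) = N.lact a (toHom m)
  map_ract : ∀ b m, toHom (M.ract b m) = N.ract b (toHom m)

/-- The category of all `A`-`B`-bimodules. -/
instance : Category (Bimodule A B) where
  Hom := Hom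
  id M := ⟨AddMonoidHom.id _, fun _ _ => rfl, fun _ _ => rfl⟩
  comp f g := ⟨g.toHom.comp f.toHom, fun a m => by simp [f.map_lact, g.map_lact],
    fun b m => by simp [f.map_ract, g.map_ract]⟩

theorem hom_ext {M N : Bimodule A B} {f g : M ⟶ N} (h : ∀ m, f.toHom m = g.toHom m) : f = g := by
  have key : ∀ f g : Hom M N, (∀ m, f.toHom m = g.toHom m) → f = g := by
    rintro ⟨f, _, _⟩ ⟨g, _, _⟩ h
    obtain rfl : f = g := AddMonoidHom.ext h
    rfl
  exact key f g h

@[simp] theorem id_toHom {M : Bimodule A B} (m : M.carrier) : (𝟙 M : M ⟶ M).toHom m = m := rfl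

@[simp] theorem comp_toHom {M N P : Bimodule A B} (f : M ⟶ N) (g : N ⟶ P) (m : M.carrier) :
    (f ≫ g).toHom m = g.toHom (f.toHom m) := rfl

/-- A bijective homomorphism of bimodules is an isomorphism. -/
noncomputable def isoOfBijective {M N : Bimodule A B} (f : M ⟶ N)
    (hf : Function.Bijective f.toHom) : M ≅ N where
  hom := f
  inv := ⟨(AddEquiv.ofBijective f.toHom hf).symm.toAddMonoidHom,
    fun a n => hf.1 (by
      change (AddEquiv.ofBijective f.toHom hf) ((AddEquiv.ofBijective f.toHom hf).symm _) =
        f.toHom (M.lact a ((AddEquiv.ofBijective f.toHom hf).symm n))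
      rw [f.map_lact, AddEquiv.apply_symm_apply]
      exact congrArg _ ((AddEquiv.ofBijective f.toHom hf).apply_symm_apply n).symm),
    fun b n => hf.1 (by
      change (AddEquiv.ofBijective f.toHom hf) ((AddEquiv.ofBijective f.toHom hf).symm _) =
        f.toHom (M.ract b ((AddEquiv.ofBijective f.toHom hf).symm n))
      rw [f.map_ract, AddEquiv.apply_symm_apply]
      exact congrArg _ ((AddEquiv.ofBijective f.toHom hf).apply_symm_apply n).symm)⟩
  hom_inv_id := hom_ext fun m => (AddEquiv.ofBijective f.toHom hf).symm_apply_apply m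
  inv_hom_id := hom_ext fun n => (AddEquiv.ofBijective f.toHom hf).apply_symm_apply n

theorem bijective_of_iso {M N : Bimodule A B} (e : M ≅ N) : Function.Bijective e.hom.toHom :=
  ⟨fun x y h => by
      simpa [← comp_toHom] using congrArg e.inv.toHom h,
    fun y => ⟨e.inv.toHom y, by simp [← comp_toHom]⟩⟩

/-! ### The tensor product over the middle ring -/

/-- The relations `m b ⊗ n = m ⊗ b n`. -/
def tensorRel (M : Bimodule A B) (N : Bimodule B C) : AddSubgroup (M.carrier ⊗[ℤ] N.carrier) :=
  AddSubgroup.closure {t | ∃ m b n, t = M.ract b m ⊗ₜ[ℤ] n - m ⊗ₜ[ℤ] N.lact b n}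

/-- The abelian group `M ⊗_B N`. -/
def Tensor (M : Bimodule A B) (N : Bimodule B C) : Type u :=
  (M.carrier ⊗[ℤ] N.carrier) ⧸ tensorRel M N

namespace Tensor

variable {M M' : Bimodule A B} {N N' : Bimodule B C}

instance : AddCommGroup (Tensor M N) :=
  inferInstanceAs (AddCommGroup ((M.carrier ⊗[ℤ] N.carrier) ⧸ tensorRel M N))

/-- The class of `m ⊗ n` in `M ⊗_B N`. -/
def mk (m : M.carrier) (n : N.carrier) : Tensor M N :=
  (QuotientAddGroup.mk (m ⊗ₜ[ℤ] n) : (M.carrier ⊗[ℤ] N.carrier) ⧸ tensorRel M N)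

theorem mk_add (m : M.carrier) (n n' : N.carrier) :
    (mk m (n + n') : Tensor M N) = mk m n + mk m n' :=
  congrArg (QuotientAddGroup.mk (s := tensorRel M N)) (TensorProduct.tmul_add m n n')

theorem add_mk (m m' : M.carrier) (n : N.carrier) :
    (mk (m + m') n : Tensor M N) = mk m n + mk m' n :=
  congrArg (QuotientAddGroup.mk (s := tensorRel M N)) (TensorProduct.add_tmul m m' n)

theorem mk_ract (b : B) (m : M.carrier) (n : N.carrier) :
    (mk (M.ract b m) n : Tensor M N) = mk m (N.lact b n) := by
  rw [← sub_eq_zero]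
  exact (QuotientAddGroup.eq_zero_iff _).2 (AddSubgroup.subset_closure ⟨m, b, n, rfl⟩)

theorem induction {p : Tensor M N → Prop} (t : Tensor M N) (hmk : ∀ m n, p (mk m n))
    (hadd : ∀ x y, p x → p y → p (x + y)) : p t := by
  obtain ⟨t, rfl⟩ := QuotientAddGroup.mk_surjective t
  refine TensorProduct.induction_on (motive := fun t => p (QuotientAddGroup.mk t)) t ?_ hmk ?_
  · have h := hmk 0 0
    rw [mk, TensorProduct.zero_tmul] at h
    exact h
  · exact fun x y hx hy => hadd _ _ hx hy

/-- The universal property: a biadditive `φ` with `φ (m b) n = φ m (b n)` factors through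
`M ⊗_B N`. -/
def lift {P : Type u} [AddCommGroup P] (φ : M.carrier → N.carrier → P)
    (hl : ∀ m m' n, φ (m + m') n = φ m n + φ m' n)
    (hr : ∀ m n n', φ m (n + n') = φ m n + φ m n')
    (h : ∀ m b n, φ (M.ract b m) n = φ m (N.lact b n)) : Tensor M N →+ P :=
  QuotientAddGroup.lift (tensorRel M N)
    (TensorProduct.liftAddHom (AddMonoidHom.mk' (fun m => AddMonoidHom.mk' (φ m) (hr m))
      fun m m' => AddMonoidHom.ext (hl m m')) fun r m n => by
        rw [map_zsmul, map_zsmul]; rfl)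
    ((AddSubgroup.closure_le _).2 (by
      rintro _ ⟨m, b, n, rfl⟩
      refine AddMonoidHom.mem_ker.2 ?_
      rw [map_sub, sub_eq_zero]
      exact h m b n))

@[simp] theorem lift_mk {P : Type u} [AddCommGroup P] (φ : M.carrier → N.carrier → P) (hl hr h)
    (m : M.carrier) (n : N.carrier) : lift (M := M) (N := N) φ hl hr h (mk m n) = φ m n := rfl

/-- The additive map `m ⊗ n ↦ f m ⊗ g n`. -/
def map (f : M.carrier →+ M'.carrier) (g : N.carrier →+ N'.carrier)
    (hf : ∀ b m, f (M.ract b m) = M'.ract b (f m))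
    (hg : ∀ b n, g (N.lact b n) = N'.lact b (g n)) : Tensor M N →+ Tensor M' N' :=
  lift (fun m n => mk (f m) (g n)) (fun m m' n => by rw [map_add, add_mk])
    (fun m n n' => by rw [map_add, mk_add]) (fun m b n => by rw [hf, hg, mk_ract])

@[simp] theorem map_mk (f : M.carrier →+ M'.carrier) (g : N.carrier →+ N'.carrier) (hf hg)
    (m : M.carrier) (n : N.carrier) :
    map (M := M) (M' := M') (N := N) (N' := N') f g hf hg (mk m n) = mk (f m) (g n) := rfl

end Tensor

/-- The bimodule `M ⊗_B N`, with `a (m ⊗ n) = a m ⊗ n` and `(m ⊗ n) c = m ⊗ n c`. -/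
def tensorObj (M : Bimodule A B) (N : Bimodule B C) : Bimodule A C where
  carrier := Tensor M N
  lact := AddMonoidHom.mk'
    (fun a => Tensor.map (M.lact a) (AddMonoidHom.id _) (fun b m => M.lact_ract a b m)
      (fun _ _ => rfl))
    (fun a a' => by
      ext t
      induction t using Tensor.induction with
      | hmk m n => simp [Tensor.add_mk]
      | hadd x y hx hy => rw [map_add, hx, hy, map_add])
  ract := AddMonoidHom.mk'
    (fun c => Tensor.map (AddMonoidHom.id _) (N.ract c) (fun _ _ => rfl)
      (fun b n => (N.lact_ract b c n).symm))
    (fun c c' => by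
      ext t
      induction t using Tensor.induction with
      | hmk m n => simp [Tensor.mk_add]
      | hadd x y hx hy => rw [map_add, hx, hy, map_add])
  lact_mul a a' t := by
    induction t using Tensor.induction with
    | hmk m n => simp [M.lact_mul]
    | hadd x y hx hy => simp only [map_add, hx, hy]
  ract_mul c c' t := by
    induction t using Tensor.induction with
    | hmk m n => simp [N.ract_mul]
    | hadd x y hx hy => simp only [map_add, hx, hy]
  lact_ract a c t := by
    induction t using Tensor.induction with
    | hmk m n => simp
    | hadd x y hx hy => simp only [map_add, hx, hy]

/-- The element `m ⊗ n` of `M ⊗_B N`. -/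
def tmul (M : Bimodule A B) (N : Bimodule B C) (m : M.carrier) (n : N.carrier) :
    (tensorObj M N).carrier :=
  Tensor.mk m n

section

variable {M M' : Bimodule A B} {N N' : Bimodule B C} {Q : Bimodule C D}

theorem tmul_add (m : M.carrier) (n n' : N.carrier) :
    tmul M N m (n + n') = tmul M N m n + tmul M N m n' := Tensor.mk_add m n n'

theorem add_tmul (m m' : M.carrier) (n : N.carrier) :
    tmul M N (m + m') n = tmul M N m n + tmul M N m' n := Tensor.add_mk m m' n

theorem ract_tmul (b : B) (m : M.carrier) (n : N.carrier) :
    tmul M N (M.ract b m) n = tmul M N m (N.lact b n) := Tensor.mk_ract b m n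

@[simp] theorem tensorObj_lact (a : A) (m : M.carrier) (n : N.carrier) :
    (tensorObj M N).lact a (tmul M N m n) = tmul M N (M.lact a m) n := rfl

@[simp] theorem tensorObj_ract (c : C) (m : M.carrier) (n : N.carrier) :
    (tensorObj M N).ract c (tmul M N m n) = tmul M N m (N.ract c n) := rfl

theorem tensor_induction {p : (tensorObj M N).carrier → Prop} (t : (tensorObj M N).carrier)
    (htmul : ∀ m n, p (tmul M N m n)) (hadd : ∀ x y, p x → p y → p (x + y)) : p t :=
  Tensor.induction (p := p) t htmul hadd

/-- The additive map out of `M ⊗_B N` with `m ⊗ n ↦ φ m n`. -/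
def liftAdd {P : Type u} [AddCommGroup P] (φ : M.carrier → N.carrier → P)
    (hl : ∀ m m' n, φ (m + m') n = φ m n + φ m' n)
    (hr : ∀ m n n', φ m (n + n') = φ m n + φ m n')
    (h : ∀ m b n, φ (M.ract b m) n = φ m (N.lact b n)) : (tensorObj M N).carrier →+ P :=
  Tensor.lift φ hl hr h

@[simp] theorem liftAdd_tmul {P : Type u} [AddCommGroup P] (φ : M.carrier → N.carrier → P)
    (hl hr h) (m : M.carrier) (n : N.carrier) :
    liftAdd (M := M) (N := N) φ hl hr h (tmul M N m n) = φ m n := rfl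

/-- The homomorphism of bimodules out of `M ⊗_B N` with `m ⊗ n ↦ φ m n`. -/
def liftHom {P : Bimodule A C} (φ : M.carrier → N.carrier → P.carrier)
    (hl : ∀ m m' n, φ (m + m') n = φ m n + φ m' n)
    (hr : ∀ m n n', φ m (n + n') = φ m n + φ m n')
    (h : ∀ m b n, φ (M.ract b m) n = φ m (N.lact b n))
    (ha : ∀ a m n, φ (M.lact a m) n = P.lact a (φ m n))
    (hc : ∀ c m n, φ m (N.ract c n) = P.ract c (φ m n)) : tensorObj M N ⟶ P where
  toHom := liftAdd φ hl hr h
  map_lact a t := by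
    induction t using tensor_induction with
    | htmul m n => simp [ha]
    | hadd x y hx hy => simp only [map_add, hx, hy]
  map_ract c t := by
    induction t using tensor_induction with
    | htmul m n => simp [hc]
    | hadd x y hx hy => simp only [map_add, hx, hy]

@[simp] theorem liftHom_tmul {P : Bimodule A C} (φ : M.carrier → N.carrier → P.carrier)
    (hl hr h ha hc) (m : M.carrier) (n : N.carrier) :
    (liftHom (M := M) (N := N) (P := P) φ hl hr h ha hc).toHom (tmul M N m n) = φ m n := rfl

theorem tensor_hom_ext {P : Bimodule A C} {f g : tensorObj M N ⟶ P}
    (h : ∀ m n, f.toHom (tmul M N m n) = g.toHom (tmul M N m n)) : f = g :=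
  hom_ext fun t => by
    induction t using tensor_induction with
    | htmul m n => exact h m n
    | hadd x y hx hy => rw [map_add, map_add, hx, hy]

/-- The homomorphism `f ⊗ g`. -/
def tensorMap (f : M ⟶ M') (g : N ⟶ N') : tensorObj M N ⟶ tensorObj M' N' :=
  liftHom (fun m n => tmul M' N' (f.toHom m) (g.toHom n))
    (fun m m' n => by rw [map_add, add_tmul]) (fun m n n' => by rw [map_add, tmul_add])
    (fun m b n => by rw [f.map_ract, g.map_lact, ract_tmul])
    (fun a m n => by rw [f.map_lact, tensorObj_lact])
    (fun c m n => by rw [g.map_ract, tensorObj_ract])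

@[simp] theorem tensorMap_tmul (f : M ⟶ M') (g : N ⟶ N') (m : M.carrier) (n : N.carrier) :
    (tensorMap f g).toHom (tmul M N m n) = tmul M' N' (f.toHom m) (g.toHom n) := rfl

theorem tensor_hom_ext₃ {P : Bimodule A D} {f g : tensorObj (tensorObj M N) Q ⟶ P}
    (h : ∀ m n q, f.toHom (tmul _ Q (tmul M N m n) q) = g.toHom (tmul _ Q (tmul M N m n) q)) :
    f = g :=
  tensor_hom_ext fun t q => by
    induction t using tensor_induction with
    | htmul m n => exact h m n q
    | hadd x y hx hy => rw [add_tmul, map_add, map_add, hx, hy]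

theorem tensor_hom_ext₃' {P : Bimodule A D} {f g : tensorObj M (tensorObj N Q) ⟶ P}
    (h : ∀ m n q, f.toHom (tmul M _ m (tmul N Q n q)) = g.toHom (tmul M _ m (tmul N Q n q))) :
    f = g :=
  tensor_hom_ext fun m t => by
    induction t using tensor_induction with
    | htmul n q => exact h m n q
    | hadd x y hx hy => rw [tmul_add, map_add, map_add, hx, hy]

/-- The map `(m ⊗ n) ⊗ q ↦ m ⊗ (n ⊗ q)`. -/
def assocHom (M : Bimodule A B) (N : Bimodule B C) (Q : Bimodule C D) :
    tensorObj (tensorObj M N) Q ⟶ tensorObj M (tensorObj N Q) :=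
  liftHom
    (fun t q => liftAdd (P := (tensorObj M (tensorObj N Q)).carrier)
      (fun m n => tmul M (tensorObj N Q) m (tmul N Q n q))
      (fun _ _ _ => add_tmul _ _ _) (fun _ _ _ => by rw [add_tmul, tmul_add])
      (fun m b n => by rw [ract_tmul, tensorObj_lact]) t)
    (fun _ _ _ => map_add _ _ _)
    (fun t q q' => by
      induction t using tensor_induction with
      | htmul m n => simp [tmul_add]
      | hadd x y hx hy => simp only [map_add, hx, hy]; abel)
    (fun t c q => by
      induction t using tensor_induction with
      | htmul m n => simp [ract_tmul]
      | hadd x y hx hy => simp only [map_add, hx, hy])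
    (fun a t q => by
      induction t using tensor_induction with
      | htmul m n => simp
      | hadd x y hx hy => simp only [map_add, hx, hy])
    (fun d t q => by
      induction t using tensor_induction with
      | htmul m n => simp
      | hadd x y hx hy => simp only [map_add, hx, hy])

/-- The map `m ⊗ (n ⊗ q) ↦ (m ⊗ n) ⊗ q`. -/
def assocInv (M : Bimodule A B) (N : Bimodule B C) (Q : Bimodule C D) :
    tensorObj M (tensorObj N Q) ⟶ tensorObj (tensorObj M N) Q :=
  liftHom
    (fun m t => liftAdd (P := (tensorObj (tensorObj M N) Q).carrier)
      (fun n q => tmul (tensorObj M N) Q (tmul M N m n) q)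
      (fun _ _ _ => by rw [tmul_add, add_tmul]) (fun _ _ _ => tmul_add _ _ _)
      (fun n c q => by rw [← ract_tmul, tensorObj_ract]) t)
    (fun m m' t => by
      induction t using tensor_induction with
      | htmul n q => simp [add_tmul]
      | hadd x y hx hy => simp only [map_add, hx, hy]; abel)
    (fun _ _ _ => map_add _ _ _)
    (fun m b t => by
      induction t using tensor_induction with
      | htmul n q => simp [ract_tmul]
      | hadd x y hx hy => simp only [map_add, hx, hy])
    (fun a m t => by
      induction t using tensor_induction with
      | htmul n q => simp
      | hadd x y hx hy => simp only [map_add, hx, hy])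
    (fun d m t => by
      induction t using tensor_induction with
      | htmul n q => simp
      | hadd x y hx hy => simp only [map_add, hx, hy])

@[simp] theorem assocHom_tmul (m : M.carrier) (n : N.carrier) (q : Q.carrier) :
    (assocHom M N Q).toHom (tmul _ Q (tmul M N m n) q) = tmul M _ m (tmul N Q n q) := rfl

@[simp] theorem assocInv_tmul (m : M.carrier) (n : N.carrier) (q : Q.carrier) :
    (assocInv M N Q).toHom (tmul M _ m (tmul N Q n q)) = tmul _ Q (tmul M N m n) q := rfl

/-- The associativity isomorphism of the tensor product. -/
def assocIso (M : Bimodule A B) (N : Bimodule B C) (Q : Bimodule C D) :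
    tensorObj (tensorObj M N) Q ≅ tensorObj M (tensorObj N Q) where
  hom := assocHom M N Q
  inv := assocInv M N Q
  hom_inv_id := tensor_hom_ext₃ fun m n q => by simp
  inv_hom_id := tensor_hom_ext₃' fun m n q => by simp

/-- `f ⊗ g` for isomorphisms `f` and `g`. -/
def tensorIso (f : M ≅ M') (g : N ≅ N') : tensorObj M N ≅ tensorObj M' N' where
  hom := tensorMap f.hom g.hom
  inv := tensorMap f.inv g.inv
  hom_inv_id := tensor_hom_ext fun m n => by
    rw [comp_toHom, tensorMap_tmul, tensorMap_tmul]; simp only [← comp_toHom]; simp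
  inv_hom_id := tensor_hom_ext fun m n => by
    rw [comp_toHom, tensorMap_tmul, tensorMap_tmul]; simp only [← comp_toHom]; simp

end

/-! ### Firm modules -/

/-- The ring `A` as an `A`-`A`-bimodule. -/
def regular (A : Type u) [NonUnitalRing A] : Bimodule A A where
  carrier := A
  lact := AddMonoidHom.mul
  ract := AddMonoidHom.mul.flip
  lact_mul a a' m := mul_assoc a a' m
  ract_mul b b' m := (mul_assoc m b b').symm
  lact_ract a b m := (mul_assoc a m b).symm

/-- The map `A ⊗_A M ⟶ M`, `a ⊗ m ↦ a m`. -/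
def lmul (M : Bimodule A B) : tensorObj (regular A) M ⟶ M :=
  liftHom (fun (a : A) m => M.lact a m) (fun a a' m =>
      congrArg (fun φ : M.carrier →+ M.carrier => φ m) (M.lact.map_add a a')) (fun _ _ _ => map_add _ _ _)
    (fun a a' m => M.lact_mul a a' m) (fun a a' m => M.lact_mul a a' m)
    (fun b a m => M.lact_ract a b m)

/-- The map `M ⊗_B B ⟶ M`, `m ⊗ b ↦ m b`. -/
def rmul (M : Bimodule A B) : tensorObj M (regular B) ⟶ M :=
  liftHom (fun m (b : B) => M.ract b m) (fun _ _ _ => map_add _ _ _) (fun m b b' =>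
      congrArg (fun φ : M.carrier →+ M.carrier => φ m) (M.ract.map_add b b'))
    (fun m b b' => (M.ract_mul b b' m).symm) (fun a m b => (M.lact_ract a b m).symm)
    (fun b' m b => M.ract_mul b b' m)

@[simp] theorem lmul_tmul {M : Bimodule A B} (a : A) (m : M.carrier) :
    (lmul M).toHom (tmul (regular A) M a m) = M.lact a m := rfl

@[simp] theorem rmul_tmul {M : Bimodule A B} (m : M.carrier) (b : B) :
    (rmul M).toHom (tmul M (regular B) m b) = M.ract b m := rfl

/-- `M` is firm as a left module. -/
def LeftFirm (M : Bimodule A B) : Prop := Function.Bijective (lmul M).toHom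

/-- `M` is firm as a right module. -/
def RightFirm (M : Bimodule A B) : Prop := Function.Bijective (rmul M).toHom

theorem LeftFirm.tensorObj {M : Bimodule A B} (hM : LeftFirm M) (N : Bimodule B C) :
    LeftFirm (tensorObj M N) := by
  have h : lmul (Bimodule.tensorObj M N) =
      ((assocIso (regular A) M N).symm ≪≫ tensorIso (isoOfBijective _ hM) (Iso.refl N)).hom :=
    tensor_hom_ext₃' fun a m n => rfl
  unfold LeftFirm
  rw [h]
  exact bijective_of_iso _

theorem RightFirm.tensorObj (M : Bimodule A B) {N : Bimodule B C} (hN : RightFirm N) :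
    RightFirm (tensorObj M N) := by
  have h : rmul (Bimodule.tensorObj M N) =
      (assocIso M N (regular C) ≪≫ tensorIso (Iso.refl M) (isoOfBijective _ hN)).hom :=
    tensor_hom_ext₃ fun m n c => rfl
  unfold RightFirm
  rw [h]
  exact bijective_of_iso _

/-- The isomorphism `A ⊗_A M ≅ M` for `M` firm on the left. -/
noncomputable def lmulIso (M : Bimodule A B) (hM : LeftFirm M) : tensorObj (regular A) M ≅ M :=
  isoOfBijective (lmul M) hM

/-- The isomorphism `M ⊗_B B ≅ M` for `M` firm on the right. -/
noncomputable def rmulIso (M : Bimodule A B) (hM : RightFirm M) : tensorObj M (regular B) ≅ M :=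
  isoOfBijective (rmul M) hM

theorem id_tensorMap {M N : Bimodule A B} (f : M ⟶ N) (hM : LeftFirm M) (hN : LeftFirm N) :
    tensorMap (𝟙 (regular A)) f = (lmulIso M hM).hom ≫ f ≫ (lmulIso N hN).inv := by
  rw [← Category.assoc, Iso.eq_comp_inv]
  exact tensor_hom_ext fun a m => (f.map_lact a m).symm

theorem tensorMap_id {M N : Bimodule A B} (f : M ⟶ N) (hM : RightFirm M) (hN : RightFirm N) :
    tensorMap f (𝟙 (regular B)) = (rmulIso M hM).hom ≫ f ≫ (rmulIso N hN).inv := by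
  rw [← Category.assoc, Iso.eq_comp_inv]
  exact tensor_hom_ext fun m b => (f.map_ract b m).symm

theorem pentagon {E : Type u} [NonUnitalRing E] (M : Bimodule A B) (N : Bimodule B C)
    (P : Bimodule C D) (Q : Bimodule D E) :
    tensorMap (assocHom M N P) (𝟙 Q) ≫ assocHom M (tensorObj N P) Q ≫
      tensorMap (𝟙 M) (assocHom N P Q) =
    assocHom (tensorObj M N) P Q ≫ assocHom M N (tensorObj P Q) :=
  tensor_hom_ext₃ fun t p q => by
    induction t using tensor_induction with
    | htmul m n => rfl
    | hadd x y hx hy => rw [add_tmul, add_tmul, map_add, map_add, hx, hy]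

end Bimodule

open Bimodule

/-! ### The bicategory of firm rings and firm bimodules -/

/-- A firm ring: `A ⊗_A A ⟶ A` is bijective. -/
structure FirmRing where
  carrier : Type u
  [ring : NonUnitalRing carrier]
  firm : Function.Bijective (rmul (regular carrier)).toHom

attribute [instance] FirmRing.ring

/-- A firm bimodule: firm as a left module and as a right module. -/
structure FirmBimodule (A B : FirmRing.{u}) where
  bimod : Bimodule A.carrier B.carrier
  leftFirm : LeftFirm bimod
  rightFirm : RightFirm bimod

instance (A B : FirmRing.{u}) : Category (FirmBimodule A B) where
  Hom M N := M.bimod ⟶ N.bimod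
  id M := 𝟙 M.bimod
  comp {M N P} f g := (f ≫ g : M.bimod ⟶ P.bimod)

namespace FirmBimodule

/-- Isomorphisms of firm bimodules are isomorphisms of bimodules. -/
def mkIso {A B : FirmRing.{u}} {M N : FirmBimodule A B} (e : M.bimod ≅ N.bimod) : M ≅ N where
  hom := e.hom
  inv := e.inv
  hom_inv_id := e.hom_inv_id
  inv_hom_id := e.inv_hom_id

end FirmBimodule

/-- The bicategory **Firm**: 0-cells are firm rings, 1-cells are firm bimodules, 2-cells are
homomorphisms of bimodules. The composite `M ≫ N` of `M : A ⟶ B` and `N : B ⟶ C` is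
`M ⊗_B N`, and the identity 1-cell of `A` is the bimodule `A`. -/
noncomputable instance : Bicategory FirmRing.{u} where
  Hom A B := FirmBimodule A B
  id A := ⟨regular A.carrier, A.firm, A.firm⟩
  comp M N := ⟨tensorObj M.bimod N.bimod, M.leftFirm.tensorObj _, N.rightFirm.tensorObj _⟩
  homCategory A B := inferInstanceAs (Category (FirmBimodule A B))
  whiskerLeft {_ _ _} M {_ _} f := tensorMap (𝟙 M.bimod) f
  whiskerRight {_ _ _} {_ _} f N := tensorMap f (𝟙 N.bimod)
  associator {_ _ _ _} M N P := FirmBimodule.mkIso (assocIso M.bimod N.bimod P.bimod)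
  leftUnitor {_ _} M := FirmBimodule.mkIso (lmulIso M.bimod M.leftFirm)
  rightUnitor {_ _} M := FirmBimodule.mkIso (rmulIso M.bimod M.rightFirm)
  whiskerLeft_id _ _ := tensor_hom_ext fun _ _ => rfl
  whiskerLeft_comp _ _ _ _ _ _ := tensor_hom_ext fun _ _ => rfl
  id_whiskerLeft {_ _ M N} f := id_tensorMap f M.leftFirm N.leftFirm
  comp_whiskerLeft _ _ _ _ _ := tensor_hom_ext₃ fun _ _ _ => rfl
  id_whiskerRight _ _ := tensor_hom_ext fun _ _ => rfl
  comp_whiskerRight _ _ _ := tensor_hom_ext fun _ _ => rfl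
  whiskerRight_id {_ _ M N} f := tensorMap_id f M.rightFirm N.rightFirm
  whiskerRight_comp _ _ _ := tensor_hom_ext₃' fun _ _ _ => rfl
  whisker_assoc _ _ _ _ _ := tensor_hom_ext₃ fun _ _ _ => rfl
  whisker_exchange _ _ := tensor_hom_ext fun _ _ => rfl
  pentagon M N P Q := Bimodule.pentagon M.bimod N.bimod P.bimod Q.bimod
  triangle {_ B _} M N := tensor_hom_ext₃ fun m (a : B.carrier) n =>
    (ract_tmul (M := M.bimod) (N := N.bimod) a m n).symm

/-! ### Firm one-sided modules and the functors `- ⊗_A M` and `N ⊗_A -` -/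

/-- A firm right `A`-module, that is, an object of `Mod_A`. A right `A`-module is the same as a
bimodule with the zero ring `PUnit` acting on the left (that action is zero, and nothing is
required of it). -/
structure FirmRightModule (A : FirmRing.{u}) where
  module : Bimodule PUnit.{u + 1} A.carrier
  firm : RightFirm module

/-- The category `Mod_A` of firm right `A`-modules. -/
instance (A : FirmRing.{u}) : Category (FirmRightModule A) where
  Hom X Y := X.module ⟶ Y.module
  id X := 𝟙 X.module
  comp {X Y Z} f g := (f ≫ g : X.module ⟶ Z.module)

/-- A firm left `A`-module, that is, an object of `_A Mod`: here the zero ring acts on the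
right. -/
structure FirmLeftModule (A : FirmRing.{u}) where
  module : Bimodule A.carrier PUnit.{u + 1}
  firm : LeftFirm module

/-- The category `_A Mod` of firm left `A`-modules. -/
instance (A : FirmRing.{u}) : Category (FirmLeftModule A) where
  Hom X Y := X.module ⟶ Y.module
  id X := 𝟙 X.module
  comp {X Y Z} f g := (f ≫ g : X.module ⟶ Z.module)

/-- The functor `- ⊗_A M : Mod_A ⥤ Mod_B`. -/
def tensorRightFunctor {A B : FirmRing.{u}} (M : FirmBimodule A B) :
    FirmRightModule A ⥤ FirmRightModule B where
  obj X := ⟨tensorObj X.module M.bimod, RightFirm.tensorObj _ M.rightFirm⟩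
  map f := tensorMap f (𝟙 M.bimod)
  map_id _ := tensor_hom_ext fun _ _ => rfl
  map_comp _ _ := tensor_hom_ext fun _ _ => rfl

/-- The functor `N ⊗_A - : _A Mod ⥤ _B Mod`. -/
def tensorLeftFunctor {A B : FirmRing.{u}} (N : FirmBimodule B A) :
    FirmLeftModule A ⥤ FirmLeftModule B where
  obj X := ⟨tensorObj N.bimod X.module, LeftFirm.tensorObj N.leftFirm _⟩
  map f := tensorMap (𝟙 N.bimod) f
  map_id _ := tensor_hom_ext fun _ _ => rfl
  map_comp _ _ := tensor_hom_ext fun _ _ => rfl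

/-! ### The monoids `I^r(S)` and `I^l(S)` -/

section Subobjects

open MonoidalCategory

variable {V : Type v} [Category.{w} V] [MonoidalCategory V]

/-- `I^r(S)`: the subobjects `i : J ⟶ S` for which `J ⊗ S ⟶ S ⊗ S ⟶ S` is an isomorphism. -/
def Ir (S : Mon V) : Type _ :=
  {J : Subobject S.X // IsIso (J.arrow ▷ S.X ≫ MonObj.mul (X := S.X))}

/-- `I^l(S)`: the subobjects `i : J ⟶ S` for which `S ⊗ J ⟶ S ⊗ S ⟶ S` is an isomorphism. -/
def Il (S : Mon V) : Type _ :=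
  {J : Subobject S.X // IsIso (S.X ◁ J.arrow ≫ MonObj.mul (X := S.X))}

/-- The multiplication map `J₁ ⊗ J₂ ⟶ S` of two subobjects of `S`. -/
noncomputable def mulMap (S : Mon V) (J₁ J₂ : Subobject S.X) : (J₁ : V) ⊗ (J₂ : V) ⟶ S.X :=
  (J₁.arrow ⊗ₘ J₂.arrow) ≫ MonObj.mul (X := S.X)

/-- The set `I` of subobjects of `S`, with `m`, is a monoid under the product of subobjects:
the product of `J₁` and `J₂` is the subobject represented by `J₁ ⊗ J₂ ⟶ S`, which is a
monomorphism, and the unit is the subobject represented by the unit `𝟙 ⟶ S` of `S`, which is a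
monomorphism as well. -/
structure IsProductOfSubobjects (S : Mon V) {I : Type*} (m : Monoid I) (sub : I → Subobject S.X) :
    Prop where
  mul : ∀ J₁ J₂ : I, ∃ _ : Mono (mulMap S (sub J₁) (sub J₂)),
    sub (J₁ * J₂) = Subobject.mk (mulMap S (sub J₁) (sub J₂))
  one : ∃ _ : Mono (MonObj.one (X := S.X)), sub 1 = Subobject.mk (MonObj.one (X := S.X))

end Subobjects

/-! ### The ring and the coring of an adjunction in a bicategory -/

section Adjunction

open Bicategory

variable {𝔹 : Type v} [Bicategory.{w, u₁} 𝔹] {a b : 𝔹} {f : a ⟶ b} {g : b ⟶ a}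

/-- The multiplication of `f ≫ g`, given by the counit `g ≫ f ⟶ 𝟙 b` in the middle. -/
def ringMul (adj : Bicategory.Adjunction f g) : (f ≫ g) ≫ (f ≫ g) ⟶ f ≫ g :=
  (α_ f g (f ≫ g)).hom ≫ f ◁ ((α_ g f g).inv ≫ adj.counit ▷ g ≫ (λ_ g).hom)

/-- The comultiplication of `g ≫ f`, given by the unit `𝟙 a ⟶ f ≫ g` in the middle. -/
def coringComul (adj : Bicategory.Adjunction f g) : g ≫ f ⟶ (g ≫ f) ≫ (g ≫ f) :=
  g ◁ ((λ_ f).inv ≫ adj.unit ▷ f ≫ (α_ f g f).hom) ≫ (α_ g f (g ≫ f)).inv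

theorem unit_ringMul (adj : Bicategory.Adjunction f g) :
    adj.unit ▷ (f ≫ g) ≫ ringMul adj = (λ_ (f ≫ g)).hom := by
  calc
    _ = 𝟙 _ ⊗≫ (leftZigzag adj.unit adj.counit) ▷ g ⊗≫ 𝟙 _ := by
      dsimp only [ringMul, leftZigzag]; bicategory
    _ = _ := by rw [adj.left_triangle]; bicategory

theorem ringMul_unit (adj : Bicategory.Adjunction f g) :
    (f ≫ g) ◁ adj.unit ≫ ringMul adj = (ρ_ (f ≫ g)).hom := by
  calc
    _ = 𝟙 _ ⊗≫ f ◁ (rightZigzag adj.unit adj.counit) ⊗≫ 𝟙 _ := by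
      dsimp only [ringMul, rightZigzag]; bicategory
    _ = _ := by rw [adj.right_triangle]; bicategory

theorem ringMul_assoc (adj : Bicategory.Adjunction f g) :
    ringMul adj ▷ (f ≫ g) ≫ ringMul adj =
      (α_ (f ≫ g) (f ≫ g) (f ≫ g)).hom ≫ (f ≫ g) ◁ ringMul adj ≫ ringMul adj := by
  calc
    _ = 𝟙 _ ⊗≫ f ◁ (adj.counit ▷ (g ≫ f) ≫ 𝟙 b ◁ adj.counit) ▷ g ⊗≫ 𝟙 _ := by
      dsimp only [ringMul]; bicategory
    _ = 𝟙 _ ⊗≫ f ◁ ((g ≫ f) ◁ adj.counit ≫ adj.counit ▷ 𝟙 b) ▷ g ⊗≫ 𝟙 _ := by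
      rw [whisker_exchange]
    _ = _ := by dsimp only [ringMul]; bicategory

theorem comul_counit (adj : Bicategory.Adjunction f g) :
    coringComul adj ≫ (g ≫ f) ◁ adj.counit = (ρ_ (g ≫ f)).inv := by
  calc
    _ = 𝟙 _ ⊗≫ g ◁ (leftZigzag adj.unit adj.counit) ⊗≫ 𝟙 _ := by
      dsimp only [coringComul, leftZigzag]; bicategory
    _ = _ := by rw [adj.left_triangle]; bicategory

theorem counit_comul (adj : Bicategory.Adjunction f g) :
    coringComul adj ≫ adj.counit ▷ (g ≫ f) = (λ_ (g ≫ f)).inv := by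
  calc
    _ = 𝟙 _ ⊗≫ (rightZigzag adj.unit adj.counit) ▷ f ⊗≫ 𝟙 _ := by
      dsimp only [coringComul, rightZigzag]; bicategory
    _ = _ := by rw [adj.right_triangle]; bicategory

theorem comul_assoc (adj : Bicategory.Adjunction f g) :
    coringComul adj ≫ (g ≫ f) ◁ coringComul adj =
      coringComul adj ≫ coringComul adj ▷ (g ≫ f) ≫ (α_ (g ≫ f) (g ≫ f) (g ≫ f)).hom := by
  calc
    _ = 𝟙 _ ⊗≫ g ◁ (adj.unit ▷ 𝟙 a ≫ (f ≫ g) ◁ adj.unit) ▷ f ⊗≫ 𝟙 _ := by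
      dsimp only [coringComul]; bicategory
    _ = 𝟙 _ ⊗≫ g ◁ (𝟙 a ◁ adj.unit ≫ adj.unit ▷ (f ≫ g)) ▷ f ⊗≫ 𝟙 _ := by
      rw [← whisker_exchange]
    _ = _ := by dsimp only [coringComul]; bicategory

/-- The monoid `S = f ≫ g` in the monoidal category of endomorphisms of `a`. -/
def ringOfAdj (adj : Bicategory.Adjunction f g) : Mon (a ⟶ a) where
  X := f ≫ g
  mon :=
    { one := adj.unit
      mul := ringMul adj
      one_mul := unit_ringMul adj
      mul_one := ringMul_unit adj
      mul_assoc := ringMul_assoc adj }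

/-- The comonoid `ℭ = g ≫ f` in the monoidal category of endomorphisms of `b`. -/
def coringOfAdj (adj : Bicategory.Adjunction f g) : Comon (b ⟶ b) where
  X := g ≫ f
  comon :=
    { counit := adj.counit
      comul := coringComul adj
      counit_comul := counit_comul adj
      comul_counit := comul_counit adj
      comul_assoc := comul_assoc adj }

/-- `ξ : J ≫ f ⟶ f`, the composite `J ≫ f ⟶ (f ≫ g) ≫ f ⟶ f ≫ (g ≫ f) ⟶ f` for
`i : J ⟶ f ≫ g`. -/
def xiRight (adj : Bicategory.Adjunction f g) {J : a ⟶ a} (i : J ⟶ f ≫ g) : J ≫ f ⟶ f :=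
  i ▷ f ≫ (α_ f g f).hom ≫ f ◁ adj.counit ≫ (ρ_ f).hom

/-- `ξ : g ≫ J ⟶ g`, the composite `g ≫ J ⟶ g ≫ (f ≫ g) ⟶ (g ≫ f) ≫ g ⟶ g` for
`i : J ⟶ f ≫ g`. -/
def xiLeft (adj : Bicategory.Adjunction f g) {J : a ⟶ a} (i : J ⟶ f ≫ g) : g ≫ J ⟶ g :=
  g ◁ i ≫ (α_ g f g).inv ≫ adj.counit ▷ g ≫ (λ_ g).hom

/-- The composite `g ≫ f ⟶ g ≫ (J ≫ f) ⟶ g ≫ ((f ≫ g) ≫ f) ⟶ (g ≫ f) ≫ (g ≫ f) ⟶ g ≫ f` of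
`g ◁ ξ⁻¹`, the inclusion `i` of `J`, and the counit on the left factor `g ≫ f`. -/
noncomputable def gammaRight (adj : Bicategory.Adjunction f g) {J : a ⟶ a} (i : J ⟶ f ≫ g)
    [IsIso (xiRight adj i)] : g ≫ f ⟶ g ≫ f :=
  g ◁ inv (xiRight adj i) ≫ g ◁ (i ▷ f) ≫ g ◁ (α_ f g f).hom ≫ (α_ g f (g ≫ f)).inv ≫
    adj.counit ▷ (g ≫ f) ≫ (λ_ (g ≫ f)).hom

/-- The composite `g ≫ f ⟶ (g ≫ J) ≫ f ⟶ (g ≫ (f ≫ g)) ≫ f ⟶ (g ≫ f) ≫ (g ≫ f) ⟶ g ≫ f` of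
`ξ⁻¹ ▷ f`, the inclusion `i` of `J`, and the counit on the right factor `g ≫ f`. -/
noncomputable def gammaLeft (adj : Bicategory.Adjunction f g) {J : a ⟶ a} (i : J ⟶ f ≫ g)
    [IsIso (xiLeft adj i)] : g ≫ f ⟶ g ≫ f :=
  inv (xiLeft adj i) ▷ f ≫ (g ◁ i) ▷ f ≫ (α_ g f g).inv ▷ f ≫ (α_ (g ≫ f) g f).hom ≫
    (g ≫ f) ◁ adj.counit ≫ (ρ_ (g ≫ f)).hom

/-- `I^r(S)` is a monoid under the product of subobjects, and `J ↦ gammaRight J` is an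
isomorphism of monoids from its opposite onto the monoid of coring endomorphisms of `ℭ` (under
composition). -/
def GammaRightIsMonoidIso (adj : Bicategory.Adjunction f g) : Prop :=
  ∃ m : Monoid (Ir (ringOfAdj adj)),
    IsProductOfSubobjects (ringOfAdj adj) m Subtype.val ∧
    ∃ Γ : (Ir (ringOfAdj adj))ᵐᵒᵖ ≃* End (coringOfAdj adj),
      ∀ J : Ir (ringOfAdj adj), ∃ _ : IsIso (xiRight adj J.1.arrow),
        (Γ (MulOpposite.op J)).hom = gammaRight adj J.1.arrow

/-- `I^l(S)` is a monoid under the product of subobjects, and `J ↦ gammaLeft J` is an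
isomorphism of monoids onto the monoid of coring endomorphisms of `ℭ` (under composition). -/
def GammaLeftIsMonoidIso (adj : Bicategory.Adjunction f g) : Prop :=
  ∃ m : Monoid (Il (ringOfAdj adj)),
    IsProductOfSubobjects (ringOfAdj adj) m Subtype.val ∧
    ∃ Γ : Il (ringOfAdj adj) ≃* End (coringOfAdj adj),
      ∀ J : Il (ringOfAdj adj), ∃ _ : IsIso (xiLeft adj J.1.arrow),
        (Γ J).hom = gammaLeft adj J.1.arrow

/-- A 1-cell with a right adjoint is separable if the unit of the adjunction is a split
monomorphism. -/
def IsSeparableCell (adj : Bicategory.Adjunction f g) : Prop := IsSplitMono adj.unit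

end Adjunction

/-- A functor is comonadic if it has a right adjoint and the comparison functor to the category
of coalgebras of the resulting comonad is an equivalence. -/
def IsComonadic {C : Type*} {D : Type*} [Category C] [Category D] (F : C ⥤ D) : Prop :=
  ∃ (U : D ⥤ C) (adj : F ⊣ U), (Comonad.comparison adj).IsEquivalence

end FirmBicat

open FirmBicat

/-! Put F = - ⊗_A M and G = - ⊗_B M†, acting between firm A-A-bimodules and firm A-B-bimodules, so
that S_M = G M. Then ξ_i : F J ⟶ M is the transpose of i : J ⟶ G M. When ξ_i is invertible, it
carries the canonical coalgebra structure of F J over to M, and the resulting coaction is ξ_i⁻¹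
followed by F i. If F is comonadic, every coaction on M arises in this way, from a monomorphism i
that is unique up to isomorphism of J (`exists_isIso_transpose`, `exists_comp_eq`). So subobjects
with invertible ξ_i correspond to coactions on M.

The other adjunction, M† ⊗_A - ⊣ M ⊗_B -, turns maps M ⟶ M ⊗ M† ⊗ M into bimodule endomorphisms φ of
ℭ_M. Under it the two coalgebra axioms become compatibility of φ with counit and comultiplication
(`coactRight_counit`, `coactRight_coassoc`). The composite correspondence is Γ_M, and its behaviour
on products is a computation with a triangle identity (`coactRight_mul`).

The map J ⊗ S_M ⟶ S_M is G ξ_i up to an associator, and it is invertible exactly when ξ_i is,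
because the counit of F ⊣ G splits at both ends of ξ_i (`isIso_xiRight_iff`). Thus I^r consists of
the subobjects considered above.

The hypothesis of (i) concerns one-sided modules, while the argument needs bimodules. In
`effectiveDescent_postcompAdj` the extra left action is descended one element at a time, and its
firmness follows because F reflects isomorphisms. If M is separable, a retraction of η splits the
unit of F ⊣ G naturally; since idempotents split in firm bimodules, this gives descent directly
(`of_retraction`). The left-hand statements are mirror images. -/

namespace FirmBicat

/-! ### Functors of effective descent -/

section Descent

variable {C D : Type*} [Category C] [Category D] {F : C ⥤ D} {G G' : D ⥤ C}

/-- The comparison functor of `F ⊣ G` is an equivalence, in terms of `F`, `G` and the unit. -/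
structure EffectiveDescent (adj : F ⊣ G) : Prop where
  faithful : ∀ {X Y : C} {s t : X ⟶ Y}, F.map s = F.map t → s = t
  full : ∀ {X Y : C} (h : F.obj X ⟶ F.obj Y),
    F.map (adj.unit.app X) ≫ F.map (G.map h) = h ≫ F.map (adj.unit.app Y) → ∃ t, F.map t = h
  essSurj : ∀ {Y : D} (y : Y ⟶ F.obj (G.obj Y)), y ≫ adj.counit.app Y = 𝟙 Y →
    y ≫ F.map (adj.unit.app (G.obj Y)) = y ≫ F.map (G.map y) →
    ∃ (X : C) (e : F.obj X ≅ Y), F.map (adj.unit.app X) ≫ F.map (G.map e.hom) = e.hom ≫ y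

/-- The comparison functor sends `X` to `F X` with coaction `F η_X`; the three fields unfold its
being faithful, full and essentially surjective. -/
theorem effectiveDescent_of_comparison (adj : F ⊣ G) [(Comonad.comparison adj).IsEquivalence] :
    EffectiveDescent adj where
  faithful {X Y s t} h := (Comonad.comparison adj).map_injective (Comonad.Coalgebra.Hom.ext h)
  full {X Y} h hh := by
    let k : (Comonad.comparison adj).obj X ⟶ (Comonad.comparison adj).obj Y := ⟨h, hh⟩
    exact ⟨(Comonad.comparison adj).preimage k,
      congrArg Comonad.Coalgebra.Hom.f ((Comonad.comparison adj).map_preimage k)⟩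
  essSurj {Y} y h₁ h₂ := by
    let Z : adj.toComonad.Coalgebra := ⟨Y, y, h₁, h₂⟩
    let e := (Comonad.comparison adj).objObjPreimageIso Z
    exact ⟨(Comonad.comparison adj).objPreimage Z, (Comonad.forget _).mapIso e, e.hom.h⟩

namespace EffectiveDescent

/-- Effective descent does not depend on the choice of the right adjoint. -/
theorem of_adjunction {adj : F ⊣ G} (h : EffectiveDescent adj) (adj' : F ⊣ G') :
    EffectiveDescent adj' := by
  let σ := adj.rightAdjointUniq adj'
  have hu : ∀ X, adj'.unit.app X = adj.unit.app X ≫ σ.hom.app (F.obj X) := fun X =>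
    (adj.unit_rightAdjointUniq_hom_app adj' X).symm
  have hu' : ∀ X, adj.unit.app X = adj'.unit.app X ≫ σ.inv.app (F.obj X) := fun X => by
    simp [hu]
  have hc : ∀ Y, adj.counit.app Y = F.map (σ.hom.app Y) ≫ adj'.counit.app Y := fun Y =>
    (adj.rightAdjointUniq_hom_app_counit adj' Y).symm
  have hc' : ∀ Y, adj'.counit.app Y = F.map (σ.inv.app Y) ≫ adj.counit.app Y := fun Y => by
    rw [hc, ← F.map_comp_assoc]; simp
  refine ⟨h.faithful, fun {X Y} k hk => h.full k ?_, fun {Y} y h₁ h₂ => ?_⟩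
  · rw [hu' X, hu' Y, F.map_comp, F.map_comp, ← reassoc_of% hk, Category.assoc]
    simp only [← F.map_comp, σ.inv.naturality]
  -- Composing the coaction with the isomorphism between the right adjoints gives a coalgebra for
  -- the comonad of `adj`.
  · obtain ⟨X, e, he⟩ := h.essSurj (y ≫ F.map (σ.inv.app Y))
      (by rw [Category.assoc, ← hc', h₁])
      (by
        have h₃ := congrArg (· ≫ F.map (σ.inv.app _) ≫ F.map (G.map (F.map (σ.inv.app Y)))) h₂
        simp only [Category.assoc, ← F.map_comp] at h₃ ⊢
        have e₁ : σ.inv.app Y ≫ adj.unit.app (G.obj Y) =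
            adj'.unit.app (G'.obj Y) ≫ σ.inv.app (F.obj (G'.obj Y)) ≫
              G.map (F.map (σ.inv.app Y)) := by
          have := adj'.unit.naturality (σ.inv.app Y)
          dsimp at this
          rw [← σ.inv.naturality, ← Category.assoc, ← this, hu' (G.obj Y), Category.assoc]
        rw [e₁, h₃, G.map_comp, σ.inv.naturality_assoc])
    refine ⟨X, e, ?_⟩
    have h₃ := he =≫ F.map (σ.hom.app Y)
    simp only [Category.assoc, ← F.map_comp, Iso.inv_hom_id_app, F.map_id] at h₃
    rw [hu, ← F.map_comp, Category.assoc, ← σ.hom.naturality, h₃]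
    simp

/-- The inverse of the coalgebra morphism `F s` is again a coalgebra morphism, so it descends;
faithfulness makes the descended map inverse to `s`. -/
theorem isIso_of_isIso_map {adj : F ⊣ G} (h : EffectiveDescent adj) {X Y : C} (s : X ⟶ Y)
    [IsIso (F.map s)] : IsIso s := by
  obtain ⟨t, ht⟩ := h.full (inv (F.map s)) (by
    rw [IsIso.eq_inv_comp, ← Category.assoc, ← F.map_comp]
    have := adj.unit.naturality s
    dsimp at this
    rw [this, ← F.map_comp, Category.assoc, ← G.map_comp]
    simp)
  exact ⟨t, h.faithful (by simp [ht]), h.faithful (by simp [ht])⟩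

/-- A left adjoint whose unit is a naturally split monomorphism is of effective descent, if
idempotents split in its domain. -/
theorem of_retraction [IsIdempotentComplete C] (adj : F ⊣ G) (π : F ⋙ G ⟶ 𝟭 C)
    (hπ : adj.unit ≫ π = 𝟙 (𝟭 C)) : EffectiveDescent adj := by
  have hπ' : ∀ X, adj.unit.app X ≫ π.app X = 𝟙 X := fun X => congr_app hπ X
  have nat : ∀ {X Y : C} (s : X ⟶ Y), G.map (F.map s) ≫ π.app Y = π.app X ≫ s :=
    fun s => π.naturality s
  have natu : ∀ {X Y : C} (s : X ⟶ Y), s ≫ adj.unit.app Y = adj.unit.app X ≫ G.map (F.map s) :=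
    fun s => adj.unit.naturality s
  refine ⟨fun {X Y s t} h => ?_, fun {X Y} k hk => ?_, fun {Y} y h₁ h₂ => ?_⟩
  · rw [← Category.id_comp s, ← Category.id_comp t, ← hπ', Category.assoc, Category.assoc,
      ← nat, ← nat, h]
  -- If `k = F t`, naturality of `π` forces `t` to be this composite.
  · refine ⟨adj.unit.app X ≫ G.map k ≫ π.app Y, ?_⟩
    rw [F.map_comp, F.map_comp, reassoc_of% hk, ← F.map_comp, hπ']
    simp
  · have h₂' : ∀ {Z} (k : F.obj (G.obj (F.obj (G.obj Y))) ⟶ Z),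
        y ≫ F.map (G.map y) ≫ k = y ≫ F.map (adj.unit.app (G.obj Y)) ≫ k := fun k => by
      rw [← reassoc_of% h₂]
    have h₃ : G.map y ≫ G.map (F.map (G.map y)) =
        G.map y ≫ G.map (F.map (adj.unit.app (G.obj Y))) := by
      rw [← G.map_comp, ← G.map_comp, h₂]
    have h₄ : (G.map y ≫ π.app _) ≫ G.map y =
        (G.map y ≫ π.app _) ≫ adj.unit.app (G.obj Y) := by
      rw [Category.assoc, ← nat, reassoc_of% h₃, nat, Category.assoc]
    -- By `h₄` the endomorphism `G y ≫ π` of `G Y` is idempotent and equalizes `G y` and the unit.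
    -- Its splitting is therefore their equalizer, to which `Y` descends.
    obtain ⟨J, i, p, hip, hpi⟩ := IsIdempotentComplete.idempotents_split (G.obj Y)
      (G.map y ≫ π.app _) (by rw [← Category.assoc, h₄, Category.assoc, hπ']; exact Category.comp_id _)
    have hi : i ≫ G.map y ≫ π.app _ = i := by rw [← hpi, reassoc_of% hip]
    have h₅ : i ≫ G.map y = i ≫ adj.unit.app (G.obj Y) := by
      have := i ≫= h₄
      simpa only [← Category.assoc, (Category.assoc _ _ _).trans hi] using this
    have h₆ : F.map i ≫ adj.counit.app Y ≫ y = F.map i := by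
      have hc : adj.counit.app Y ≫ y = F.map (G.map y) ≫ adj.counit.app _ :=
        (adj.counit.naturality y).symm
      rw [hc, ← Category.assoc, ← F.map_comp, h₅, F.map_comp, Category.assoc]
      simp
    refine ⟨J, ⟨F.map i ≫ adj.counit.app Y, y ≫ F.map p, ?_, ?_⟩, ?_⟩
    · rw [Category.assoc, reassoc_of% h₆, ← F.map_comp, hip, F.map_id]
    · rw [Category.assoc, ← Category.assoc (F.map p), ← F.map_comp, hpi, F.map_comp,
        Category.assoc, h₂', ← Category.assoc (F.map _) (F.map _), ← F.map_comp, hπ', F.map_id,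
        Category.id_comp, h₁]
    · dsimp only
      rw [Category.assoc, h₆, G.map_comp, ← F.map_comp, ← Category.assoc, ← natu]
      simp

/-! ### Subobjects of `G m` and coalgebra structures on `m` -/

/-- The transpose of `i : J ⟶ G m`. -/
def transpose (adj : F ⊣ G) {J : C} {m : D} (i : J ⟶ G.obj m) : F.obj J ⟶ m :=
  F.map i ≫ adj.counit.app m

theorem transpose_def (adj : F ⊣ G) {J : C} {m : D} (i : J ⟶ G.obj m) :
    transpose adj i = F.map i ≫ adj.counit.app m := rfl

theorem unit_map_transpose (adj : F ⊣ G) {J : C} {m : D} (i : J ⟶ G.obj m) :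
    adj.unit.app J ≫ G.map (transpose adj i) = i := by
  have := adj.unit.naturality i
  dsimp at this
  rw [transpose_def, G.map_comp, ← Category.assoc, ← this, Category.assoc, adj.right_triangle_components,
    Category.comp_id]

variable {adj : F ⊣ G} {m : D}

/-- The transpose of `s ≫ i` is `F s` followed by an isomorphism, so `s ≫ i` determines `F s`, and
`F` is faithful. -/
theorem mono_of_isIso_transpose (h : EffectiveDescent adj) {J : C} (i : J ⟶ G.obj m)
    [IsIso (transpose adj i)] : Mono i where
  right_cancellation s t hst := h.faithful <| by
    rw [← cancel_mono (transpose adj i), transpose_def, ← Category.assoc, ← Category.assoc,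
      ← F.map_comp, ← F.map_comp, hst]

/-- The structure of a coalgebra on `m` given by a morphism with an invertible transpose. -/
theorem coalgebra_of_isIso_transpose (adj : F ⊣ G) {J : C} (i : J ⟶ G.obj m)
    [IsIso (transpose adj i)] (y : m ⟶ F.obj (G.obj m)) (hy : transpose adj i ≫ y = F.map i) :
    y ≫ adj.counit.app m = 𝟙 m ∧ y ≫ F.map (adj.unit.app (G.obj m)) = y ≫ F.map (G.map y) := by
  constructor
  · rw [← cancel_epi (transpose adj i), reassoc_of% hy, Category.comp_id, transpose_def]
  · have hu := adj.unit.naturality i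
    dsimp at hu
    rw [← cancel_epi (transpose adj i), reassoc_of% hy, reassoc_of% hy, ← F.map_comp,
      ← F.map_comp, hu, ← hy]
    nth_rw 2 [← unit_map_transpose adj i]
    rw [G.map_comp, Category.assoc]

/-- Both transposes are isomorphisms of coalgebras onto `(m, y)`, so one followed by the inverse of
the other is a coalgebra morphism `F J ⟶ F J'` and descends. Used in both directions, this shows
that the coaction determines the subobject. -/
theorem exists_comp_eq (h : EffectiveDescent adj) {J J' : C} {i : J ⟶ G.obj m}
    {i' : J' ⟶ G.obj m} [IsIso (transpose adj i)] [IsIso (transpose adj i')]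
    {y : m ⟶ F.obj (G.obj m)} (hy : transpose adj i ≫ y = F.map i)
    (hy' : transpose adj i' ≫ y = F.map i') : ∃ t : J ⟶ J', t ≫ i' = i := by
  have key : ∀ {J : C} (i : J ⟶ G.obj m), F.map i =
      F.map (adj.unit.app J) ≫ F.map (G.map (transpose adj i)) := fun i => by
    rw [← F.map_comp, unit_map_transpose]
  obtain ⟨t, ht⟩ := h.full (transpose adj i ≫ inv (transpose adj i')) (by
    rw [G.map_comp, F.map_comp, ← Category.assoc, ← key, ← hy, Category.assoc, Category.assoc]
    have h₁ : y ≫ F.map (G.map (inv (transpose adj i'))) =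
        inv (transpose adj i') ≫ F.map (adj.unit.app J') := by
      rw [IsIso.eq_inv_comp, ← Category.assoc, hy', key i', Category.assoc, ← F.map_comp,
        ← G.map_comp]
      simp
    rw [h₁])
  refine ⟨t, ?_⟩
  rw [← unit_map_transpose adj (t ≫ i'), ← unit_map_transpose adj i, transpose_def adj (t ≫ i'),
    F.map_comp, Category.assoc, ht, ← transpose_def, Category.assoc, IsIso.inv_hom_id,
    Category.comp_id]

/-- A coalgebra isomorphism `e : F J ≅ m` is the transpose of `η_J ≫ G e`. -/
theorem exists_isIso_transpose (h : EffectiveDescent adj) {y : m ⟶ F.obj (G.obj m)}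
    (h₁ : y ≫ adj.counit.app m = 𝟙 m)
    (h₂ : y ≫ F.map (adj.unit.app (G.obj m)) = y ≫ F.map (G.map y)) :
    ∃ (J : C) (i : J ⟶ G.obj m), IsIso (transpose adj i) ∧ transpose adj i ≫ y = F.map i := by
  obtain ⟨J, e, he⟩ := h.essSurj y h₁ h₂
  have ht : transpose adj (adj.unit.app J ≫ G.map e.hom) = e.hom := by
    simp [transpose_def]
  exact ⟨J, adj.unit.app J ≫ G.map e.hom, by rw [ht]; infer_instance,
    by rw [ht, F.map_comp, he]⟩

end EffectiveDescent

end Descent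

/-! ### Monoids of subobjects -/

section Assembly

open MonoidalCategory

variable {V : Type v} [Category.{w} V] [MonoidalCategory V]

/-- A relation between morphisms into `S` and the elements of a monoid `E` which is multiplicative
and bijective on subobjects defines a monoid of subobjects isomorphic to the opposite of `E`. -/
theorem exists_monoid_mulEquiv (S : Mon V) {E : Type*} [Monoid E]
    (P : Subobject S.X → Prop) (R : ∀ {J : V}, (J ⟶ S.X) → E → Prop)
    (hP : ∀ J : Subobject S.X, P J ↔ ∃ φ, R J.arrow φ)
    (uniq : ∀ {J : V} {i : J ⟶ S.X} {φ ψ : E}, R i φ → R i ψ → φ = ψ)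
    (mono : ∀ {J : V} {i : J ⟶ S.X} {φ : E}, R i φ → Mono i)
    (iso : ∀ {J J' : V} (e : J' ≅ J) {i : J ⟶ S.X} {φ : E}, R i φ → R (e.hom ≫ i) φ)
    (inj : ∀ {J J' : V} {i : J ⟶ S.X} {i' : J' ⟶ S.X} {φ : E}, R i φ → R i' φ →
      ∃ t : J ⟶ J', t ≫ i' = i)
    (surj : ∀ φ : E, ∃ (J : V) (i : J ⟶ S.X), R i φ)
    (mul : ∀ {J J' : V} {i : J ⟶ S.X} {i' : J' ⟶ S.X} {φ ψ : E}, R i φ → R i' ψ →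
      R ((i ⊗ₘ i') ≫ MonObj.mul (X := S.X)) (ψ * φ))
    (one : R (MonObj.one (X := S.X)) 1) :
    ∃ m : Monoid {J : Subobject S.X // P J}, IsProductOfSubobjects S m Subtype.val ∧
      ∃ Γ : {J : Subobject S.X // P J}ᵐᵒᵖ ≃* E, ∀ J : {J : Subobject S.X // P J},
        R J.1.arrow (Γ (MulOpposite.op J)) := by
  choose γ hγ using fun J : {J : Subobject S.X // P J} => (hP J.1).1 J.2
  have hmk : ∀ {J : V} {i : J ⟶ S.X} {φ : E} (_ : R i φ) [Mono i],
      R (Subobject.mk i).arrow φ := fun {J i φ} h _ => by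
    have := iso (Subobject.underlyingIso i) h
    rwa [Subobject.underlyingIso_hom_comp_eq_mk] at this
  have hinj : Function.Injective γ := fun J J' h => by
    have h₁ := hγ J
    have h₂ := hγ J'
    rw [h] at h₁
    obtain ⟨s, hs⟩ := inj h₁ h₂
    obtain ⟨t, ht⟩ := inj h₂ h₁
    exact Subtype.ext (le_antisymm (Subobject.le_of_comm s hs) (Subobject.le_of_comm t ht))
  have hsurj : Function.Surjective γ := fun φ => by
    obtain ⟨J, i, hi⟩ := surj φ
    have := mono hi
    exact ⟨⟨Subobject.mk i, (hP _).2 ⟨φ, hmk hi⟩⟩, uniq (hγ ⟨Subobject.mk i, _⟩) (hmk hi)⟩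
  -- The multiplication is transported from `Eᵐᵒᵖ`; `hval` later identifies it with the product of
  -- subobjects.
  let e : {J : Subobject S.X // P J} ≃ Eᵐᵒᵖ :=
    (Equiv.ofBijective γ ⟨hinj, hsurj⟩).trans MulOpposite.opEquiv
  let m : Monoid {J : Subobject S.X // P J} := e.monoid
  have hmul : ∀ J J' : {J : Subobject S.X // P J}, γ (J * J') = γ J' * γ J := fun J J' =>
    congrArg MulOpposite.unop (e.apply_symm_apply (e J * e J'))
  have hone : γ 1 = 1 := congrArg MulOpposite.unop (e.apply_symm_apply 1)
  have hval : ∀ (J : {J : Subobject S.X // P J}) {X : V} {i : X ⟶ S.X} [Mono i],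
      R i (γ J) → J.1 = Subobject.mk i := fun J X i _ h =>
    congrArg Subtype.val (hinj (uniq (hmk h) (hγ ⟨Subobject.mk i, (hP _).2 ⟨_, hmk h⟩⟩)))
  refine ⟨m, ⟨fun J J' => ?_, ?_⟩, ⟨⟨⟨fun J => γ J.unop, fun φ => MulOpposite.op (e.symm
    (MulOpposite.op φ)), fun J => ?_, fun φ => ?_⟩, fun J J' => hmul _ _⟩, fun J => hγ J⟩⟩
  -- The product map is not known in advance to be a monomorphism. It becomes one because it is
  -- related to an element of `E`, which is why `R` is a relation on all morphisms into `S`.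
  · have h : R (mulMap S J.1 J'.1) (γ (J * J')) := hmul J J' ▸ mul (hγ J) (hγ J')
    have := mono h
    exact ⟨this, hval _ h⟩
  · have h : R (MonObj.one (X := S.X)) (γ 1) := hone ▸ one
    have := mono h
    exact ⟨this, hval _ h⟩
  · exact congrArg MulOpposite.op (e.symm_apply_apply J.unop)
  · exact congrArg MulOpposite.unop (e.apply_symm_apply (MulOpposite.op φ))

end Assembly

/-- The section `s` of the counit at `Z` yields a one-sided inverse `t` of `x`. The section `r`
makes `G` faithful on maps out of `Y`, and `G (x ≫ t)` is an identity because `G x` is invertible.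
-/
theorem isIso_of_isIso_map_of_counit {C D : Type*} [Category C] [Category D] {F : C ⥤ D}
    {G : D ⥤ C} (adj : F ⊣ G) {Y Z : D} (x : Y ⟶ Z) {r : Y ⟶ F.obj (G.obj Y)}
    (hr : r ≫ adj.counit.app Y = 𝟙 Y) {s : Z ⟶ F.obj (G.obj Z)}
    (hs : s ≫ adj.counit.app Z = 𝟙 Z) [IsIso (G.map x)] : IsIso x := by
  have nat : ∀ {Y Z : D} (x : Y ⟶ Z), F.map (G.map x) ≫ adj.counit.app Z = adj.counit.app Y ≫ x :=
    fun x => adj.counit.naturality x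
  let t : Z ⟶ Y := s ≫ F.map (inv (G.map x)) ≫ adj.counit.app Y
  have htx : t ≫ x = 𝟙 Z := by
    rw [Category.assoc, Category.assoc, ← nat, ← Category.assoc (F.map _), ← F.map_comp,
      IsIso.inv_hom_id, F.map_id, Category.id_comp, hs]
  have hG : G.map (x ≫ t) = 𝟙 _ := by
    have ht : G.map t ≫ G.map x = 𝟙 _ := by rw [← G.map_comp, htx, G.map_id]
    rw [G.map_comp, (IsIso.eq_inv_of_inv_hom_id ht :), IsIso.hom_inv_id]
  refine ⟨t, ?_, htx⟩
  rw [← Category.id_comp (x ≫ t), ← hr, Category.assoc, ← nat, hG, F.map_id, Category.id_comp]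

/-! ### Composition with the two 1-cells of an adjunction -/

section Adjunction

open Bicategory

variable {𝔹 : Type v} [Bicategory.{w, u₁} 𝔹] {a b : 𝔹} {f : a ⟶ b} {g : b ⟶ a}

/-- The adjunction `- ≫ f ⊣ - ≫ g` given by `f ⊣ g`. -/
def postcompAdj (adj : Bicategory.Adjunction f g) (c : 𝔹) : postcomp c f ⊣ postcomp c g :=
  CategoryTheory.Adjunction.mkOfUnitCounit
    { unit :=
        { app := fun X => (ρ_ X).inv ≫ X ◁ adj.unit ≫ (α_ X f g).inv
          naturality := fun X Y s => by
            dsimp [postcomp]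
            calc
              _ = 𝟙 _ ⊗≫ (s ▷ 𝟙 a ≫ Y ◁ adj.unit) ⊗≫ 𝟙 _ := by bicategory
              _ = _ := by rw [← whisker_exchange]; bicategory }
      counit :=
        { app := fun Y => (α_ Y g f).hom ≫ Y ◁ adj.counit ≫ (ρ_ Y).hom
          naturality := fun X Y s => by
            dsimp [postcomp]
            calc
              _ = 𝟙 _ ⊗≫ (s ▷ (g ≫ f) ≫ Y ◁ adj.counit) ⊗≫ 𝟙 _ := by bicategory
              _ = _ := by rw [← whisker_exchange]; bicategory }
      left_triangle := by
        ext X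
        dsimp [postcomp]
        calc
          _ = 𝟙 _ ⊗≫ X ◁ leftZigzag adj.unit adj.counit ⊗≫ 𝟙 _ := by
            dsimp only [leftZigzag]; bicategory
          _ = _ := by rw [adj.left_triangle]; bicategory
      right_triangle := by
        ext X
        dsimp [postcomp]
        calc
          _ = 𝟙 _ ⊗≫ X ◁ rightZigzag adj.unit adj.counit ⊗≫ 𝟙 _ := by
            dsimp only [rightZigzag]; bicategory
          _ = _ := by rw [adj.right_triangle]; bicategory }

/-- The adjunction `g ≫ - ⊣ f ≫ -` given by `f ⊣ g`. -/
def precompAdj (adj : Bicategory.Adjunction f g) (c : 𝔹) : precomp c g ⊣ precomp c f :=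
  CategoryTheory.Adjunction.mkOfUnitCounit
    { unit :=
        { app := fun X => (λ_ X).inv ≫ adj.unit ▷ X ≫ (α_ f g X).hom
          naturality := fun X Y s => by
            dsimp [precomp]
            calc
              _ = 𝟙 _ ⊗≫ (𝟙 a ◁ s ≫ adj.unit ▷ Y) ⊗≫ 𝟙 _ := by bicategory
              _ = _ := by rw [whisker_exchange]; bicategory }
      counit :=
        { app := fun Y => (α_ g f Y).inv ≫ adj.counit ▷ Y ≫ (λ_ Y).hom
          naturality := fun X Y s => by
            dsimp [precomp]
            calc
              _ = 𝟙 _ ⊗≫ ((g ≫ f) ◁ s ≫ adj.counit ▷ Y) ⊗≫ 𝟙 _ := by bicategory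
              _ = _ := by rw [whisker_exchange]; bicategory }
      left_triangle := by
        ext X
        dsimp [precomp]
        calc
          _ = 𝟙 _ ⊗≫ rightZigzag adj.unit adj.counit ▷ X ⊗≫ 𝟙 _ := by
            dsimp only [rightZigzag]; bicategory
          _ = _ := by rw [adj.right_triangle]; bicategory
      right_triangle := by
        ext X
        dsimp [precomp]
        calc
          _ = 𝟙 _ ⊗≫ leftZigzag adj.unit adj.counit ▷ X ⊗≫ 𝟙 _ := by
            dsimp only [leftZigzag]; bicategory
          _ = _ := by rw [adj.left_triangle]; bicategory }

@[simp] theorem postcompAdj_unit (adj : Bicategory.Adjunction f g) (c : 𝔹) (X : c ⟶ a) :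
    (postcompAdj adj c).unit.app X = (ρ_ X).inv ≫ X ◁ adj.unit ≫ (α_ X f g).inv := rfl

@[simp] theorem postcompAdj_counit (adj : Bicategory.Adjunction f g) (c : 𝔹) (Y : c ⟶ b) :
    (postcompAdj adj c).counit.app Y = (α_ Y g f).hom ≫ Y ◁ adj.counit ≫ (ρ_ Y).hom := rfl

@[simp] theorem precompAdj_unit (adj : Bicategory.Adjunction f g) (c : 𝔹) (X : a ⟶ c) :
    (precompAdj adj c).unit.app X = (λ_ X).inv ≫ adj.unit ▷ X ≫ (α_ f g X).hom := rfl

@[simp] theorem precompAdj_counit (adj : Bicategory.Adjunction f g) (c : 𝔹) (Y : b ⟶ c) :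
    (precompAdj adj c).counit.app Y = (α_ g f Y).inv ≫ adj.counit ▷ Y ≫ (λ_ Y).hom := rfl

/-! ### Right-hand version: coactions on `f` and coring endomorphisms -/

/-- Morphisms out of the coring `g ≫ f` correspond to morphisms out of `f`. -/
def mateRight (adj : Bicategory.Adjunction f g) {k : b ⟶ b} : (g ≫ f ⟶ k) ≃ (f ⟶ f ≫ k) :=
  (precompAdj adj b).homEquiv f k

theorem mateRight_apply (adj : Bicategory.Adjunction f g) {k : b ⟶ b} (φ : g ≫ f ⟶ k) :
    mateRight adj φ = (λ_ f).inv ≫ adj.unit ▷ f ≫ (α_ f g f).hom ≫ f ◁ φ := by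
  refine (CategoryTheory.Adjunction.homEquiv_unit ..).trans ?_
  simp [precomp]

theorem mateRight_symm_apply (adj : Bicategory.Adjunction f g) {k : b ⟶ b} (δ : f ⟶ f ≫ k) :
    (mateRight adj).symm δ = g ◁ δ ≫ (α_ g f k).inv ≫ adj.counit ▷ k ≫ (λ_ k).hom := by
  refine (CategoryTheory.Adjunction.homEquiv_counit ..).trans ?_
  simp [precomp]

theorem mateRight_comp (adj : Bicategory.Adjunction f g) {k l : b ⟶ b} (φ : g ≫ f ⟶ k)
    (ψ : k ⟶ l) : mateRight adj (φ ≫ ψ) = mateRight adj φ ≫ f ◁ ψ := by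
  simp [mateRight_apply]

/-- The coaction of the comonad of `- ≫ f ⊣ - ≫ g` on `f` given by an endomorphism of the
coring. -/
def coactRight (adj : Bicategory.Adjunction f g) (φ : g ≫ f ⟶ g ≫ f) : f ⟶ (f ≫ g) ≫ f :=
  mateRight adj φ ≫ (α_ f g f).inv

/-- By the left triangle identity the mate of the counit is an inverse unitor, so the two conditions
are mates of each other. -/
theorem coactRight_counit (adj : Bicategory.Adjunction f g) (φ : g ≫ f ⟶ g ≫ f) :
    coactRight adj φ ≫ (α_ f g f).hom ≫ f ◁ adj.counit ≫ (ρ_ f).hom = 𝟙 f ↔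
      φ ≫ adj.counit = adj.counit := by
  have h : mateRight adj adj.counit = (ρ_ f).inv := by
    have := adj.left_triangle
    rw [mateRight_apply, Iso.inv_comp_eq, ← this, leftZigzag]
    bicategory
  rw [← (mateRight adj).apply_eq_iff_eq, h, mateRight_comp, coactRight,
    ← cancel_mono (ρ_ f).hom]
  simp

/-- Together with `coactRight_coactRight`, this writes the two sides of coassociativity as mates of
the two sides of compatibility with the comultiplication, followed by one and the same isomorphism.
-/
theorem coactRight_unit (adj : Bicategory.Adjunction f g) (φ : g ≫ f ⟶ g ≫ f) :
    coactRight adj φ ≫ ((ρ_ (f ≫ g)).inv ≫ (f ≫ g) ◁ adj.unit ≫ (α_ (f ≫ g) f g).inv) ▷ f =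
      mateRight adj (φ ≫ coringComul adj) ≫ (α_ f (g ≫ f) (g ≫ f)).inv ≫
        (α_ (f ≫ g ≫ f) g f).inv ≫ (α_ f g f).inv ▷ g ▷ f := by
  rw [mateRight_comp, coactRight, Category.assoc, Category.assoc]
  congr 1
  dsimp only [coringComul]
  bicategory

/-- Interchange moves the second unit past the first `φ`, and the two units then form the
comultiplication. No triangle identity is needed. -/
theorem coactRight_coactRight (adj : Bicategory.Adjunction f g) (φ : g ≫ f ⟶ g ≫ f) :
    coactRight adj φ ≫ coactRight adj φ ▷ g ▷ f =
      mateRight adj (coringComul adj ≫ φ ▷ (g ≫ f) ≫ (g ≫ f) ◁ φ) ≫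
        (α_ f (g ≫ f) (g ≫ f)).inv ≫ (α_ (f ≫ g ≫ f) g f).inv ≫ (α_ f g f).inv ▷ g ▷ f := by
  simp only [coactRight, mateRight_apply, coringComul]
  calc
    _ = 𝟙 _ ⊗≫ adj.unit ▷ f ⊗≫ (𝟙 a ◁ f ◁ φ ≫ adj.unit ▷ (f ≫ g ≫ f)) ⊗≫
        f ◁ φ ▷ g ▷ f ⊗≫ 𝟙 _ := by bicategory
    _ = 𝟙 _ ⊗≫ ((𝟙 a ◁ adj.unit ≫ adj.unit ▷ (f ≫ g)) ▷ f) ⊗≫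
        f ◁ ((g ≫ f) ◁ φ ≫ φ ▷ (g ≫ f)) ⊗≫ 𝟙 _ := by
      rw [whisker_exchange]; bicategory
    _ = _ := by
      rw [whisker_exchange, whisker_exchange]; bicategory

theorem coactRight_coassoc (adj : Bicategory.Adjunction f g) (φ : g ≫ f ⟶ g ≫ f) :
    coactRight adj φ ≫ ((ρ_ (f ≫ g)).inv ≫ (f ≫ g) ◁ adj.unit ≫ (α_ (f ≫ g) f g).inv) ▷ f =
      coactRight adj φ ≫ coactRight adj φ ▷ g ▷ f ↔
      φ ≫ coringComul adj = coringComul adj ≫ φ ▷ (g ≫ f) ≫ (g ≫ f) ◁ φ := by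
  rw [coactRight_unit, coactRight_coactRight, cancel_mono, (mateRight adj).apply_eq_iff_eq]

theorem xiRight_comp (adj : Bicategory.Adjunction f g) {J J' : a ⟶ a} (e : J' ⟶ J)
    (i : J ⟶ f ≫ g) : xiRight adj (e ≫ i) = e ▷ f ≫ xiRight adj i := by
  simp [xiRight]

/-- `gammaRight` is the inverse mate of ξ⁻¹ followed by `i ▷ f`. The inverse-free equation on the
right is the one that `coalgebra_of_isIso_transpose` requires, ξ being the transpose of `i`. -/
theorem eq_gammaRight_iff (adj : Bicategory.Adjunction f g) {J : a ⟶ a} (i : J ⟶ f ≫ g)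
    [IsIso (xiRight adj i)] (φ : g ≫ f ⟶ g ≫ f) :
    φ = gammaRight adj i ↔ xiRight adj i ≫ coactRight adj φ = i ▷ f := by
  have : gammaRight adj i = (mateRight adj).symm (inv (xiRight adj i) ≫ i ▷ f ≫ (α_ f g f).hom) := by
    simp [gammaRight, mateRight_symm_apply]
  rw [this, Equiv.eq_symm_apply, IsIso.eq_inv_comp, coactRight, ← Category.assoc,
    Iso.comp_inv_eq]

/-- Relates the map that defines `Ir` to the image of ξ under `- ≫ g`. -/
theorem whiskerRight_ringMul (adj : Bicategory.Adjunction f g) {J : a ⟶ a} (i : J ⟶ f ≫ g) :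
    i ▷ (f ≫ g) ≫ ringMul adj = (α_ J f g).inv ≫ xiRight adj i ▷ g := by
  dsimp only [ringMul, xiRight]
  bicategory

/-- ξ is the action of the ring `f ≫ g` on `f`, restricted along `i`, and this action is
associative. Hence invertibility of ξ passes to products. -/
theorem xiRight_mul (adj : Bicategory.Adjunction f g) {J J' : a ⟶ a} (i : J ⟶ f ≫ g)
    (i' : J' ⟶ f ≫ g) : xiRight adj ((i ▷ J' ≫ (f ≫ g) ◁ i') ≫ ringMul adj) =
      (α_ J J' f).hom ≫ J ◁ xiRight adj i' ≫ xiRight adj i := by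
  dsimp only [ringMul, xiRight]
  calc
    _ = 𝟙 _ ⊗≫ (i ▷ J' ≫ (f ≫ g) ◁ i') ▷ f ⊗≫ f ◁ (adj.counit ▷ (g ≫ f) ≫ 𝟙 b ◁ adj.counit) ⊗≫
        𝟙 _ := by bicategory
    _ = 𝟙 _ ⊗≫ (J ◁ i' ≫ i ▷ (f ≫ g)) ▷ f ⊗≫ f ◁ ((g ≫ f) ◁ adj.counit ≫ adj.counit ▷ 𝟙 b) ⊗≫
        𝟙 _ := by rw [whisker_exchange, whisker_exchange]
    _ = 𝟙 _ ⊗≫ J ◁ (i' ▷ f) ⊗≫ (i ▷ (f ≫ (g ≫ f)) ≫ (f ≫ g) ◁ f ◁ adj.counit) ⊗≫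
        f ◁ adj.counit ⊗≫ 𝟙 _ := by bicategory
    _ = _ := by rw [← whisker_exchange]; bicategory

/-- The unit inside the coaction of `ψ` meets the counit inside the product; the right triangle
identity cancels them and leaves `φ ≫ ψ`. -/
theorem coactRight_mul (adj : Bicategory.Adjunction f g) {J J' : a ⟶ a} {i : J ⟶ f ≫ g}
    {i' : J' ⟶ f ≫ g} {φ ψ : g ≫ f ⟶ g ≫ f} (h : xiRight adj i ≫ coactRight adj φ = i ▷ f)
    (h' : xiRight adj i' ≫ coactRight adj ψ = i' ▷ f) :
    xiRight adj ((i ▷ J' ≫ (f ≫ g) ◁ i') ≫ ringMul adj) ≫ coactRight adj (φ ≫ ψ) =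
      ((i ▷ J' ≫ (f ≫ g) ◁ i') ≫ ringMul adj) ▷ f := by
  have h₁ : coactRight adj (φ ≫ ψ) =
      coactRight adj φ ≫ (α_ f g f).hom ≫ f ◁ ψ ≫ (α_ f g f).inv := by
    simp [coactRight, mateRight_comp]
  rw [xiRight_mul, h₁, Category.assoc, Category.assoc, reassoc_of% h]
  symm
  calc
    _ = 𝟙 _ ⊗≫ i ▷ (J' ≫ f) ⊗≫ (f ≫ g) ◁ (i' ▷ f) ⊗≫ f ◁ adj.counit ▷ (g ≫ f) ⊗≫ 𝟙 _ := by
      dsimp only [ringMul]; bicategory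
    _ = 𝟙 _ ⊗≫ (i ▷ (J' ≫ f) ≫ (f ≫ g) ◁ xiRight adj i') ⊗≫ f ◁ g ◁ adj.unit ▷ f ⊗≫
        f ◁ ((g ≫ f) ◁ ψ ≫ adj.counit ▷ (g ≫ f)) ⊗≫ 𝟙 _ := by
      rw [← h', coactRight, mateRight_apply]; bicategory
    _ = 𝟙 _ ⊗≫ (J ◁ xiRight adj i' ≫ i ▷ f) ⊗≫ f ◁ rightZigzag adj.unit adj.counit ▷ f ⊗≫
        f ◁ ψ ⊗≫ 𝟙 _ := by
      rw [whisker_exchange, ← whisker_exchange]; dsimp only [rightZigzag]; bicategory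
    _ = _ := by rw [adj.right_triangle]; bicategory

theorem xiRight_unit (adj : Bicategory.Adjunction f g) : xiRight adj adj.unit = (λ_ f).hom := by
  have h := adj.left_triangle
  calc
    _ = leftZigzag adj.unit adj.counit ⊗≫ 𝟙 _ := by dsimp only [xiRight, leftZigzag]; bicategory
    _ = _ := by rw [h]; bicategory

/-- The functor `- ≫ g` reflects invertibility of ξ because the counit splits at both ends: at `J ≫
f` by a triangle identity, at `f` by the coaction of the identity of the coring. -/
theorem isIso_xiRight_iff (adj : Bicategory.Adjunction f g) {J : a ⟶ a} (i : J ⟶ f ≫ g) :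
    IsIso (i ▷ (f ≫ g) ≫ ringMul adj) ↔ IsIso (xiRight adj i) := by
  rw [whiskerRight_ringMul]
  refine ⟨fun h => ?_, fun h => inferInstance⟩
  have h₁ : IsIso ((postcomp a g).map (xiRight adj i)) := by
    rwa [isIso_comp_left_iff] at h
  exact isIso_of_isIso_map_of_counit (postcompAdj adj a) (xiRight adj i)
    ((postcompAdj adj a).left_triangle_components J)
    ((coactRight_counit adj (𝟙 _)).2 (Category.id_comp _))

/-- `φ` is the endomorphism `gammaRight i`, which is defined. -/
def IsGammaRight (adj : Bicategory.Adjunction f g) {J : a ⟶ a} (i : J ⟶ f ≫ g)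
    (φ : g ≫ f ⟶ g ≫ f) : Prop :=
  ∃ _ : IsIso (xiRight adj i), φ = gammaRight adj i

theorem isGammaRight_iff (adj : Bicategory.Adjunction f g) {J : a ⟶ a} (i : J ⟶ f ≫ g)
    (φ : g ≫ f ⟶ g ≫ f) :
    IsGammaRight adj i φ ↔ IsIso (xiRight adj i) ∧ xiRight adj i ≫ coactRight adj φ = i ▷ f :=
  ⟨fun ⟨h, hφ⟩ => ⟨h, (eq_gammaRight_iff adj i φ).1 hφ⟩,
    fun ⟨h, hφ⟩ => ⟨h, (eq_gammaRight_iff adj i φ).2 hφ⟩⟩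

theorem IsGammaRight.iso_comp {adj : Bicategory.Adjunction f g} {J J' : a ⟶ a} (e : J' ≅ J)
    {i : J ⟶ f ≫ g} {φ : g ≫ f ⟶ g ≫ f} (h : IsGammaRight adj i φ) :
    IsGammaRight adj (e.hom ≫ i) φ := by
  rw [isGammaRight_iff] at h ⊢
  obtain ⟨_, h⟩ := h
  rw [xiRight_comp, Category.assoc, h, comp_whiskerRight]
  exact ⟨inferInstance, rfl⟩

theorem IsGammaRight.mul {adj : Bicategory.Adjunction f g} {J J' : a ⟶ a} {i : J ⟶ f ≫ g}
    {i' : J' ⟶ f ≫ g} {φ ψ : g ≫ f ⟶ g ≫ f} (h : IsGammaRight adj i φ)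
    (h' : IsGammaRight adj i' ψ) :
    IsGammaRight adj ((i ▷ J' ≫ (f ≫ g) ◁ i') ≫ ringMul adj) (φ ≫ ψ) := by
  rw [isGammaRight_iff] at h h' ⊢
  obtain ⟨_, h⟩ := h
  obtain ⟨_, h'⟩ := h'
  exact ⟨by rw [xiRight_mul]; infer_instance, coactRight_mul adj h h'⟩

theorem IsGammaRight.one (adj : Bicategory.Adjunction f g) :
    IsGammaRight adj adj.unit (𝟙 (g ≫ f)) := by
  rw [isGammaRight_iff, xiRight_unit]
  exact ⟨inferInstance, by simp [coactRight, mateRight_apply]⟩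

/-- An invertible transpose always produces a coaction, so this direction needs no descent. -/
theorem exists_isGammaRight (adj : Bicategory.Adjunction f g) {J : a ⟶ a} (i : J ⟶ f ≫ g)
    [IsIso (xiRight adj i)] : ∃ φ : End (coringOfAdj adj), IsGammaRight adj i φ.hom := by
  have : IsIso (EffectiveDescent.transpose (postcompAdj adj a) (m := f) i) :=
    inferInstanceAs (IsIso (xiRight adj i))
  obtain ⟨h₁, h₂⟩ := EffectiveDescent.coalgebra_of_isIso_transpose (postcompAdj adj a) (m := f) i
    (coactRight adj (gammaRight adj i)) ((eq_gammaRight_iff adj i _).1 rfl)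
  let c : IsComonHom (M := (coringOfAdj adj).X) (N := (coringOfAdj adj).X) (gammaRight adj i) :=
    ⟨(coactRight_counit adj _).1 h₁, (coactRight_coassoc adj _).1 h₂⟩
  exact ⟨Comon.Hom.mk (M := coringOfAdj adj) (N := coringOfAdj adj) (gammaRight adj i),
    inferInstance, rfl⟩

/-- If `- ≫ f` is of effective descent, then the monoid of subobjects of `f ≫ g` is isomorphic to
the opposite of the monoid of endomorphisms of the coring `g ≫ f`. -/
theorem gammaRightIsMonoidIso_of_effectiveDescent (adj : Bicategory.Adjunction f g)
    (h : EffectiveDescent (postcompAdj adj a)) : GammaRightIsMonoidIso adj := by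
  refine exists_monoid_mulEquiv (ringOfAdj adj) (E := End (coringOfAdj adj))
    (fun J => IsIso (J.arrow ▷ (f ≫ g) ≫ ringMul adj))
    (fun {J} i φ => IsGammaRight adj i φ.hom)
    (fun J => (isIso_xiRight_iff adj J.arrow).trans
      ⟨fun _ => exists_isGammaRight adj J.arrow, fun ⟨_, hJ, _⟩ => hJ⟩)
    (fun ⟨_, h₁⟩ ⟨_, h₂⟩ => Comon.Hom.ext (h₁.trans h₂.symm))
    (fun {J i φ} ⟨hi, _⟩ => ?_) (fun e => IsGammaRight.iso_comp e) (fun {J J' i i' φ} hi hi' => ?_)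
    -- In `End`, the product `ψ * φ` is `φ ≫ ψ`, the order given by `IsGammaRight.mul`.
    (fun φ => ?_) (fun hi hi' => hi.mul hi') (IsGammaRight.one adj)
  · have : IsIso (EffectiveDescent.transpose (postcompAdj adj a) (m := f) i) := hi
    exact h.mono_of_isIso_transpose (m := f) i
  · obtain ⟨h₁, h₂⟩ := (isGammaRight_iff adj i _).1 hi
    obtain ⟨h₁', h₂'⟩ := (isGammaRight_iff adj i' _).1 hi'
    have : IsIso (EffectiveDescent.transpose (postcompAdj adj a) (m := f) i) := h₁
    have : IsIso (EffectiveDescent.transpose (postcompAdj adj a) (m := f) i') := h₁'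
    exact h.exists_comp_eq (m := f) h₂ h₂'
  · obtain ⟨J, i, hi⟩ := h.exists_isIso_transpose (m := f)
      ((coactRight_counit adj φ.hom).2 φ.isComonHom_hom.hom_counit)
      ((coactRight_coassoc adj φ.hom).2 φ.isComonHom_hom.hom_comul)
    exact ⟨J, i, (isGammaRight_iff adj i φ.hom).2 hi⟩

/-! ### Left-hand version: coactions on `g` and coring endomorphisms -/

/-- Morphisms out of the coring `g ≫ f` correspond to morphisms out of `g`. -/
def mateLeft (adj : Bicategory.Adjunction f g) {k : b ⟶ b} : (g ≫ f ⟶ k) ≃ (g ⟶ k ≫ g) :=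
  (postcompAdj adj b).homEquiv g k

theorem mateLeft_apply (adj : Bicategory.Adjunction f g) {k : b ⟶ b} (φ : g ≫ f ⟶ k) :
    mateLeft adj φ = (ρ_ g).inv ≫ g ◁ adj.unit ≫ (α_ g f g).inv ≫ φ ▷ g := by
  refine (CategoryTheory.Adjunction.homEquiv_unit ..).trans ?_
  simp [postcomp]

theorem mateLeft_symm_apply (adj : Bicategory.Adjunction f g) {k : b ⟶ b} (δ : g ⟶ k ≫ g) :
    (mateLeft adj).symm δ = δ ▷ f ≫ (α_ k g f).hom ≫ k ◁ adj.counit ≫ (ρ_ k).hom := by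
  refine (CategoryTheory.Adjunction.homEquiv_counit ..).trans ?_
  simp [postcomp]

theorem mateLeft_comp (adj : Bicategory.Adjunction f g) {k l : b ⟶ b} (φ : g ≫ f ⟶ k)
    (ψ : k ⟶ l) : mateLeft adj (φ ≫ ψ) = mateLeft adj φ ≫ ψ ▷ g := by
  simp [mateLeft_apply]

/-- The coaction of the comonad of `g ≫ - ⊣ f ≫ -` on `g` given by an endomorphism of the
coring. -/
def coactLeft (adj : Bicategory.Adjunction f g) (φ : g ≫ f ⟶ g ≫ f) : g ⟶ g ≫ f ≫ g :=
  mateLeft adj φ ≫ (α_ g f g).hom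

theorem coactLeft_counit (adj : Bicategory.Adjunction f g) (φ : g ≫ f ⟶ g ≫ f) :
    coactLeft adj φ ≫ (α_ g f g).inv ≫ adj.counit ▷ g ≫ (λ_ g).hom = 𝟙 g ↔
      φ ≫ adj.counit = adj.counit := by
  have h : mateLeft adj adj.counit = (λ_ g).inv := by
    have := adj.right_triangle
    rw [mateLeft_apply, Iso.inv_comp_eq, ← this, rightZigzag]
    bicategory
  rw [← (mateLeft adj).apply_eq_iff_eq, h, mateLeft_comp, coactLeft,
    ← cancel_mono (λ_ g).hom]
  simp

theorem coactLeft_unit (adj : Bicategory.Adjunction f g) (φ : g ≫ f ⟶ g ≫ f) :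
    coactLeft adj φ ≫ g ◁ ((λ_ (f ≫ g)).inv ≫ adj.unit ▷ (f ≫ g) ≫ (α_ f g (f ≫ g)).hom) =
      mateLeft adj (φ ≫ coringComul adj) ≫ (α_ (g ≫ f) (g ≫ f) g).hom ≫
        (α_ g f ((g ≫ f) ≫ g)).hom ≫ g ◁ f ◁ (α_ g f g).hom := by
  rw [mateLeft_comp, coactLeft, Category.assoc, Category.assoc]
  congr 1
  dsimp only [coringComul]
  bicategory

theorem coactLeft_coactLeft (adj : Bicategory.Adjunction f g) (φ : g ≫ f ⟶ g ≫ f) :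
    coactLeft adj φ ≫ g ◁ f ◁ coactLeft adj φ =
      mateLeft adj (coringComul adj ≫ φ ▷ (g ≫ f) ≫ (g ≫ f) ◁ φ) ≫
        (α_ (g ≫ f) (g ≫ f) g).hom ≫ (α_ g f ((g ≫ f) ≫ g)).hom ≫ g ◁ f ◁ (α_ g f g).hom := by
  simp only [coactLeft, mateLeft_apply, coringComul]
  calc
    _ = 𝟙 _ ⊗≫ g ◁ adj.unit ⊗≫ (φ ▷ g ▷ 𝟙 a ≫ ((g ≫ f) ≫ g) ◁ adj.unit) ⊗≫
        g ◁ f ◁ φ ▷ g ⊗≫ 𝟙 _ := by bicategory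
    _ = 𝟙 _ ⊗≫ (g ◁ (adj.unit ▷ 𝟙 a ≫ (f ≫ g) ◁ adj.unit)) ⊗≫
        (φ ▷ (g ≫ f) ≫ (g ≫ f) ◁ φ) ▷ g ⊗≫ 𝟙 _ := by
      rw [← whisker_exchange]; bicategory
    _ = _ := by
      rw [← whisker_exchange]; bicategory

theorem coactLeft_coassoc (adj : Bicategory.Adjunction f g) (φ : g ≫ f ⟶ g ≫ f) :
    coactLeft adj φ ≫ g ◁ ((λ_ (f ≫ g)).inv ≫ adj.unit ▷ (f ≫ g) ≫ (α_ f g (f ≫ g)).hom) =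
      coactLeft adj φ ≫ g ◁ f ◁ coactLeft adj φ ↔
      φ ≫ coringComul adj = coringComul adj ≫ φ ▷ (g ≫ f) ≫ (g ≫ f) ◁ φ := by
  rw [coactLeft_unit, coactLeft_coactLeft, cancel_mono, (mateLeft adj).apply_eq_iff_eq]

theorem xiLeft_comp (adj : Bicategory.Adjunction f g) {J J' : a ⟶ a} (e : J' ⟶ J)
    (i : J ⟶ f ≫ g) : xiLeft adj (e ≫ i) = g ◁ e ≫ xiLeft adj i := by
  simp [xiLeft]

theorem eq_gammaLeft_iff (adj : Bicategory.Adjunction f g) {J : a ⟶ a} (i : J ⟶ f ≫ g)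
    [IsIso (xiLeft adj i)] (φ : g ≫ f ⟶ g ≫ f) :
    φ = gammaLeft adj i ↔ xiLeft adj i ≫ coactLeft adj φ = g ◁ i := by
  have : gammaLeft adj i = (mateLeft adj).symm (inv (xiLeft adj i) ≫ g ◁ i ≫ (α_ g f g).inv) := by
    simp [gammaLeft, mateLeft_symm_apply]
  rw [this, Equiv.eq_symm_apply, IsIso.eq_inv_comp, coactLeft, ← Category.assoc,
    Iso.eq_comp_inv]

theorem whiskerLeft_ringMul (adj : Bicategory.Adjunction f g) {J : a ⟶ a} (i : J ⟶ f ≫ g) :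
    (f ≫ g) ◁ i ≫ ringMul adj = (α_ f g J).hom ≫ f ◁ xiLeft adj i := by
  dsimp only [ringMul, xiLeft]
  bicategory

/-- The ring acts on `g` from the right, so in a product `J` acts before `J'`. This reversal is why
no opposite monoid appears in the left-hand statement. -/
theorem xiLeft_mul (adj : Bicategory.Adjunction f g) {J J' : a ⟶ a} (i : J ⟶ f ≫ g)
    (i' : J' ⟶ f ≫ g) : xiLeft adj ((i ▷ J' ≫ (f ≫ g) ◁ i') ≫ ringMul adj) =
      (α_ g J J').inv ≫ xiLeft adj i ▷ J' ≫ xiLeft adj i' := by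
  dsimp only [ringMul, xiLeft]
  calc
    _ = 𝟙 _ ⊗≫ g ◁ i ▷ J' ⊗≫ g ◁ (f ≫ g) ◁ i' ⊗≫ ((g ≫ f) ◁ adj.counit ≫ adj.counit ▷ 𝟙 b) ▷ g ⊗≫
        𝟙 _ := by bicategory
    _ = 𝟙 _ ⊗≫ g ◁ i ▷ J' ⊗≫ ((g ≫ f) ◁ (g ◁ i') ≫ adj.counit ▷ (g ≫ (f ≫ g))) ⊗≫
        adj.counit ▷ g ⊗≫ 𝟙 _ := by rw [whisker_exchange]; bicategory
    _ = _ := by rw [whisker_exchange]; bicategory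

/-- Here the unit comes from the coaction of `φ`, and the left triangle identity cancels it against
the counit of the product, leaving `ψ ≫ φ`. -/
theorem coactLeft_mul (adj : Bicategory.Adjunction f g) {J J' : a ⟶ a} {i : J ⟶ f ≫ g}
    {i' : J' ⟶ f ≫ g} {φ ψ : g ≫ f ⟶ g ≫ f} (h : xiLeft adj i ≫ coactLeft adj φ = g ◁ i)
    (h' : xiLeft adj i' ≫ coactLeft adj ψ = g ◁ i') :
    xiLeft adj ((i ▷ J' ≫ (f ≫ g) ◁ i') ≫ ringMul adj) ≫ coactLeft adj (ψ ≫ φ) =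
      g ◁ ((i ▷ J' ≫ (f ≫ g) ◁ i') ≫ ringMul adj) := by
  have h₁ : coactLeft adj (ψ ≫ φ) =
      coactLeft adj ψ ≫ (α_ g f g).inv ≫ φ ▷ g ≫ (α_ g f g).hom := by
    simp [coactLeft, mateLeft_comp]
  rw [xiLeft_mul, h₁, Category.assoc, Category.assoc, reassoc_of% h']
  symm
  calc
    _ = 𝟙 _ ⊗≫ (g ◁ i) ▷ J' ⊗≫ (g ≫ f ≫ g) ◁ i' ⊗≫ (g ≫ f) ◁ adj.counit ▷ g ⊗≫ 𝟙 _ := by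
      dsimp only [ringMul]; bicategory
    _ = 𝟙 _ ⊗≫ xiLeft adj i ▷ J' ⊗≫ (coactLeft adj φ ▷ J' ≫ (g ≫ f ≫ g) ◁ i') ⊗≫
        (g ≫ f) ◁ adj.counit ▷ g ⊗≫ 𝟙 _ := by
      rw [← h]; bicategory
    _ = 𝟙 _ ⊗≫ xiLeft adj i ▷ J' ⊗≫ g ◁ i' ⊗≫ g ◁ adj.unit ▷ f ▷ g ⊗≫
        (φ ▷ (g ≫ f) ≫ (g ≫ f) ◁ adj.counit) ▷ g ⊗≫ 𝟙 _ := by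
      rw [← whisker_exchange, coactLeft, mateLeft_apply]; bicategory
    _ = 𝟙 _ ⊗≫ xiLeft adj i ▷ J' ⊗≫ g ◁ i' ⊗≫ g ◁ leftZigzag adj.unit adj.counit ▷ g ⊗≫
        φ ▷ g ⊗≫ 𝟙 _ := by
      rw [← whisker_exchange]; dsimp only [leftZigzag]; bicategory
    _ = _ := by rw [adj.left_triangle]; bicategory

theorem xiLeft_unit (adj : Bicategory.Adjunction f g) : xiLeft adj adj.unit = (ρ_ g).hom := by
  have h := adj.right_triangle
  calc
    _ = rightZigzag adj.unit adj.counit ⊗≫ 𝟙 _ := by dsimp only [xiLeft, rightZigzag]; bicategory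
    _ = _ := by rw [h]; bicategory

theorem isIso_xiLeft_iff (adj : Bicategory.Adjunction f g) {J : a ⟶ a} (i : J ⟶ f ≫ g) :
    IsIso ((f ≫ g) ◁ i ≫ ringMul adj) ↔ IsIso (xiLeft adj i) := by
  rw [whiskerLeft_ringMul]
  refine ⟨fun h => ?_, fun h => inferInstance⟩
  have h₁ : IsIso ((precomp a f).map (xiLeft adj i)) := by
    rwa [isIso_comp_left_iff] at h
  exact isIso_of_isIso_map_of_counit (precompAdj adj a) (xiLeft adj i)
    ((precompAdj adj a).left_triangle_components J)
    ((coactLeft_counit adj (𝟙 _)).2 (Category.id_comp _))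

/-- `φ` is the endomorphism `gammaLeft i`, which is defined. -/
def IsGammaLeft (adj : Bicategory.Adjunction f g) {J : a ⟶ a} (i : J ⟶ f ≫ g)
    (φ : g ≫ f ⟶ g ≫ f) : Prop :=
  ∃ _ : IsIso (xiLeft adj i), φ = gammaLeft adj i

theorem isGammaLeft_iff (adj : Bicategory.Adjunction f g) {J : a ⟶ a} (i : J ⟶ f ≫ g)
    (φ : g ≫ f ⟶ g ≫ f) :
    IsGammaLeft adj i φ ↔ IsIso (xiLeft adj i) ∧ xiLeft adj i ≫ coactLeft adj φ = g ◁ i :=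
  ⟨fun ⟨h, hφ⟩ => ⟨h, (eq_gammaLeft_iff adj i φ).1 hφ⟩,
    fun ⟨h, hφ⟩ => ⟨h, (eq_gammaLeft_iff adj i φ).2 hφ⟩⟩

theorem IsGammaLeft.iso_comp {adj : Bicategory.Adjunction f g} {J J' : a ⟶ a} (e : J' ≅ J)
    {i : J ⟶ f ≫ g} {φ : g ≫ f ⟶ g ≫ f} (h : IsGammaLeft adj i φ) :
    IsGammaLeft adj (e.hom ≫ i) φ := by
  rw [isGammaLeft_iff] at h ⊢
  obtain ⟨_, h⟩ := h
  rw [xiLeft_comp, Category.assoc, h, whiskerLeft_comp]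
  exact ⟨inferInstance, rfl⟩

theorem IsGammaLeft.mul {adj : Bicategory.Adjunction f g} {J J' : a ⟶ a} {i : J ⟶ f ≫ g}
    {i' : J' ⟶ f ≫ g} {φ ψ : g ≫ f ⟶ g ≫ f} (h : IsGammaLeft adj i φ)
    (h' : IsGammaLeft adj i' ψ) :
    IsGammaLeft adj ((i ▷ J' ≫ (f ≫ g) ◁ i') ≫ ringMul adj) (ψ ≫ φ) := by
  rw [isGammaLeft_iff] at h h' ⊢
  obtain ⟨_, h⟩ := h
  obtain ⟨_, h'⟩ := h'
  exact ⟨by rw [xiLeft_mul]; infer_instance, coactLeft_mul adj h h'⟩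

theorem IsGammaLeft.one (adj : Bicategory.Adjunction f g) :
    IsGammaLeft adj adj.unit (𝟙 (g ≫ f)) := by
  rw [isGammaLeft_iff, xiLeft_unit]
  exact ⟨inferInstance, by simp [coactLeft, mateLeft_apply]⟩

theorem exists_isGammaLeft (adj : Bicategory.Adjunction f g) {J : a ⟶ a} (i : J ⟶ f ≫ g)
    [IsIso (xiLeft adj i)] : ∃ φ : End (coringOfAdj adj), IsGammaLeft adj i φ.hom := by
  have : IsIso (EffectiveDescent.transpose (precompAdj adj a) (m := g) i) :=
    inferInstanceAs (IsIso (xiLeft adj i))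
  obtain ⟨h₁, h₂⟩ := EffectiveDescent.coalgebra_of_isIso_transpose (precompAdj adj a) (m := g) i
    (coactLeft adj (gammaLeft adj i)) ((eq_gammaLeft_iff adj i _).1 rfl)
  let c : IsComonHom (M := (coringOfAdj adj).X) (N := (coringOfAdj adj).X) (gammaLeft adj i) :=
    ⟨(coactLeft_counit adj _).1 h₁, (coactLeft_coassoc adj _).1 h₂⟩
  exact ⟨Comon.Hom.mk (M := coringOfAdj adj) (N := coringOfAdj adj) (gammaLeft adj i),
    inferInstance, rfl⟩

/-- If `g ≫ -` is of effective descent, then the monoid of subobjects of `f ≫ g` is isomorphic to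
the monoid of endomorphisms of the coring `g ≫ f`. -/
theorem gammaLeftIsMonoidIso_of_effectiveDescent (adj : Bicategory.Adjunction f g)
    (h : EffectiveDescent (precompAdj adj a)) : GammaLeftIsMonoidIso adj := by
  -- The general lemma yields anti-isomorphisms onto `E`. Taking for `E` the opposite of `End`
  -- matches the order in `IsGammaLeft.mul`, and the two opposites are removed at the end.
  obtain ⟨m, hm, Γ, hΓ⟩ := exists_monoid_mulEquiv (ringOfAdj adj) (E := (End (coringOfAdj adj))ᵐᵒᵖ)
    (fun J => IsIso ((f ≫ g) ◁ J.arrow ≫ ringMul adj))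
    (fun {J} i φ => IsGammaLeft adj i φ.unop.hom)
    (fun J => (isIso_xiLeft_iff adj J.arrow).trans
      ⟨fun _ => (exists_isGammaLeft adj J.arrow).imp' MulOpposite.op fun _ => id,
        fun ⟨_, hJ, _⟩ => hJ⟩)
    (fun ⟨_, h₁⟩ ⟨_, h₂⟩ => MulOpposite.unop_injective (Comon.Hom.ext (h₁.trans h₂.symm)))
    (fun {J i φ} ⟨hi, _⟩ => by
      have : IsIso (EffectiveDescent.transpose (precompAdj adj a) (m := g) i) := hi
      exact h.mono_of_isIso_transpose (m := g) i)
    (fun e => IsGammaLeft.iso_comp e)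
    (fun {J J' i i' φ} hi hi' => by
      obtain ⟨h₁, h₂⟩ := (isGammaLeft_iff adj i _).1 hi
      obtain ⟨h₁', h₂'⟩ := (isGammaLeft_iff adj i' _).1 hi'
      have : IsIso (EffectiveDescent.transpose (precompAdj adj a) (m := g) i) := h₁
      have : IsIso (EffectiveDescent.transpose (precompAdj adj a) (m := g) i') := h₁'
      exact h.exists_comp_eq (m := g) h₂ h₂')
    (fun φ => by
      obtain ⟨J, i, hi⟩ := h.exists_isIso_transpose (m := g)
        ((coactLeft_counit adj φ.unop.hom).2 φ.unop.isComonHom_hom.hom_counit)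
        ((coactLeft_coassoc adj φ.unop.hom).2 φ.unop.isComonHom_hom.hom_comul)
      exact ⟨J, i, (isGammaLeft_iff adj i φ.unop.hom).2 hi⟩)
    (fun hi hi' => hi.mul hi') (IsGammaLeft.one adj)
  let m' : Monoid (Il (ringOfAdj adj)) := m
  exact ⟨m', hm, (MulEquiv.op (α := Il (ringOfAdj adj)) (β := End (coringOfAdj adj))).symm Γ, hΓ⟩

/-! ### The separable case: descent from a retraction of the unit -/

theorem effectiveDescent_postcompAdj_of_retraction (adj : Bicategory.Adjunction f g) (c : 𝔹)
    [IsIdempotentComplete (c ⟶ a)] (π : f ≫ g ⟶ 𝟙 a) (hπ : adj.unit ≫ π = 𝟙 (𝟙 a)) :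
    EffectiveDescent (postcompAdj adj c) := by
  -- Whiskering `π` with `X` retracts the unit at `X`, naturally in `X` by interchange.
  refine .of_retraction _
    { app := fun X => (α_ X f g).hom ≫ X ◁ π ≫ (ρ_ X).hom
      naturality := fun X Y s => by
        dsimp [postcomp]
        calc
          _ = 𝟙 _ ⊗≫ (s ▷ (f ≫ g) ≫ Y ◁ π) ⊗≫ 𝟙 _ := by bicategory
          _ = _ := by rw [← whisker_exchange]; bicategory } ?_
  ext X
  change ((ρ_ X).inv ≫ X ◁ adj.unit ≫ (α_ X f g).inv) ≫ (α_ X f g).hom ≫ X ◁ π ≫ (ρ_ X).hom =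
    𝟙 X
  simp [← Bicategory.whiskerLeft_comp_assoc, hπ]

theorem effectiveDescent_precompAdj_of_retraction (adj : Bicategory.Adjunction f g) (c : 𝔹)
    [IsIdempotentComplete (a ⟶ c)] (π : f ≫ g ⟶ 𝟙 a) (hπ : adj.unit ≫ π = 𝟙 (𝟙 a)) :
    EffectiveDescent (precompAdj adj c) := by
  refine .of_retraction _
    { app := fun X => (α_ f g X).inv ≫ π ▷ X ≫ (λ_ X).hom
      naturality := fun X Y s => by
        dsimp [precomp]
        calc
          _ = 𝟙 _ ⊗≫ ((f ≫ g) ◁ s ≫ π ▷ Y) ⊗≫ 𝟙 _ := by bicategory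
          _ = _ := by rw [whisker_exchange]; bicategory } ?_
  ext X
  change ((λ_ X).inv ≫ adj.unit ▷ X ≫ (α_ f g X).hom) ≫ (α_ f g X).inv ≫ π ▷ X ≫ (λ_ X).hom =
    𝟙 X
  simp [← Bicategory.comp_whiskerRight_assoc, hπ]

end Adjunction

/-! ### Idempotents in the category of firm bimodules -/

namespace Bimodule

variable {A B : Type u} [NonUnitalRing A] [NonUnitalRing B]

/-- A subgroup which is stable under both actions. -/
def ofStable (X : Bimodule A B) (H : AddSubgroup X.carrier)
    (hl : ∀ a, ∀ x ∈ H, X.lact a x ∈ H) (hr : ∀ b, ∀ x ∈ H, X.ract b x ∈ H) : Bimodule A B where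
  carrier := H
  lact := AddMonoidHom.mk' (fun a => ((X.lact a).comp H.subtype).codRestrict H
      fun x => hl a x x.2) fun a a' => by
    ext x
    exact congrArg (fun φ : X.carrier →+ X.carrier => φ x) (X.lact.map_add a a')
  ract := AddMonoidHom.mk' (fun b => ((X.ract b).comp H.subtype).codRestrict H
      fun x => hr b x x.2) fun b b' => by
    ext x
    exact congrArg (fun φ : X.carrier →+ X.carrier => φ x) (X.ract.map_add b b')
  lact_mul a a' x := Subtype.ext (X.lact_mul a a' x)
  ract_mul b b' x := Subtype.ext (X.ract_mul b b' x)
  lact_ract a b x := Subtype.ext (X.lact_ract a b x)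

/-- An idempotent splits through its subgroup of fixed points. -/
theorem exists_splitting (X : Bimodule A B) (p : X ⟶ X) (hp : p ≫ p = p) :
    ∃ (Y : Bimodule A B) (i : Y ⟶ X) (e : X ⟶ Y), i ≫ e = 𝟙 Y ∧ e ≫ i = p := by
  have hp' : ∀ x, p.toHom (p.toHom x) = p.toHom x := fun x =>
    congrArg (fun q : X ⟶ X => q.toHom x) hp
  let H : AddSubgroup X.carrier := p.toHom.eqLocus (AddMonoidHom.id _)
  have hH : ∀ x, x ∈ H ↔ p.toHom x = x := fun x => Iff.rfl
  let Y := X.ofStable H (fun a x hx => by rw [hH, p.map_lact, (hH x).1 hx])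
    (fun b x hx => by rw [hH, p.map_ract, (hH x).1 hx])
  let i : Hom Y X := ⟨H.subtype, fun _ _ => rfl, fun _ _ => rfl⟩
  let e : Hom X Y := ⟨p.toHom.codRestrict H fun x => hp' x,
    fun a x => Subtype.ext (p.map_lact a x), fun b x => Subtype.ext (p.map_ract b x)⟩
  exact ⟨Y, i, e, hom_ext fun x => Subtype.ext x.2, hom_ext fun x => rfl⟩

/-- By naturality the multiplication map of `Y` is a retract of that of `X`, and a retract of an
isomorphism is an isomorphism. -/
theorem LeftFirm.of_retract {X Y : Bimodule A B} (hX : LeftFirm X) (i : Y ⟶ X) (e : X ⟶ Y)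
    (h : i ≫ e = 𝟙 Y) : LeftFirm Y := by
  have nat : ∀ {X Y : Bimodule A B} (s : X ⟶ Y),
      tensorMap (𝟙 (regular A)) s ≫ lmul Y = lmul X ≫ s :=
    fun s => tensor_hom_ext fun a m => (s.map_lact a m).symm
  have h' : tensorMap (𝟙 (regular A)) i ≫ tensorMap (𝟙 (regular A)) e = 𝟙 _ :=
    tensor_hom_ext fun a m => congrArg (tmul _ _ a) (congrArg (fun q : Y ⟶ Y => q.toHom m) h)
  let E := isoOfBijective _ hX
  have hE : E.hom = lmul X := rfl
  refine bijective_of_iso (M := Bimodule.tensorObj (regular A) Y) (N := Y)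
    ⟨lmul Y, i ≫ E.inv ≫ tensorMap (𝟙 (regular A)) e, ?_, ?_⟩
  · rw [← Category.assoc, ← nat, ← hE]
    simp [h']
  · rw [Category.assoc, Category.assoc, nat, ← hE]
    simp [h]

theorem RightFirm.of_retract {X Y : Bimodule A B} (hX : RightFirm X) (i : Y ⟶ X) (e : X ⟶ Y)
    (h : i ≫ e = 𝟙 Y) : RightFirm Y := by
  have nat : ∀ {X Y : Bimodule A B} (s : X ⟶ Y),
      tensorMap s (𝟙 (regular B)) ≫ rmul Y = rmul X ≫ s :=
    fun s => tensor_hom_ext fun m b => (s.map_ract b m).symm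
  have h' : tensorMap i (𝟙 (regular B)) ≫ tensorMap e (𝟙 (regular B)) = 𝟙 _ :=
    tensor_hom_ext fun m b =>
      congrArg (fun m => tmul Y (regular B) m b) (congrArg (fun q : Y ⟶ Y => q.toHom m) h)
  let E := isoOfBijective _ hX
  have hE : E.hom = rmul X := rfl
  refine bijective_of_iso (M := Bimodule.tensorObj Y (regular B)) (N := Y)
    ⟨rmul Y, i ≫ E.inv ≫ tensorMap e (𝟙 (regular B)), ?_, ?_⟩
  · rw [← Category.assoc, ← nat, ← hE]
    simp [h']
  · rw [Category.assoc, Category.assoc, nat, ← hE]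
    simp [h]

end Bimodule

open Bimodule

instance (A B : FirmRing.{u}) : IsIdempotentComplete (A ⟶ B) where
  idempotents_split X p hp := by
    obtain ⟨Y, i, e, hie, hei⟩ := exists_splitting X.bimod p hp
    exact ⟨⟨Y, X.leftFirm.of_retract i e hie, X.rightFirm.of_retract i e hie⟩, i, e, hie, hei⟩

/-- Descent is obtained directly on firm bimodules; one-sided modules do not enter. -/
theorem gammaIsMonoidIso_of_isSeparableCell {A B : FirmRing.{u}} {M : A ⟶ B} {N : B ⟶ A}
    (adj : Bicategory.Adjunction M N) (h : IsSeparableCell adj) :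
    GammaRightIsMonoidIso adj ∧ GammaLeftIsMonoidIso adj := by
  obtain ⟨⟨π, hπ⟩⟩ := h
  exact ⟨gammaRightIsMonoidIso_of_effectiveDescent adj
      (effectiveDescent_postcompAdj_of_retraction adj A π hπ),
    gammaLeftIsMonoidIso_of_effectiveDescent adj
      (effectiveDescent_precompAdj_of_retraction adj A π hπ)⟩

/-! ### The adjunction `- ⊗_A M ⊣ - ⊗_B N` between categories of firm right modules -/

section RightModules

variable {A B : FirmRing.{u}} {M : A ⟶ B} {N : B ⟶ A}

/-- The map `X ⟶ X ⊗_A M ⊗_B N` given by the unit of an adjunction. -/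
noncomputable def rightUnit (adj : Bicategory.Adjunction M N) {R : Type u} [NonUnitalRing R]
    {X : Bimodule R A.carrier} (hX : RightFirm X) :
    X ⟶ tensorObj (tensorObj X M.bimod) N.bimod :=
  (rmulIso X hX).inv ≫ tensorMap (𝟙 X) (adj.unit : regular A.carrier ⟶ _) ≫ assocInv _ _ _

/-- The map `Y ⊗_B N ⊗_A M ⟶ Y` given by the counit of an adjunction. -/
noncomputable def rightCounit (adj : Bicategory.Adjunction M N) {R : Type u} [NonUnitalRing R]
    (Y : Bimodule R B.carrier) : tensorObj (tensorObj Y N.bimod) M.bimod ⟶ Y :=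
  assocHom _ _ _ ≫ tensorMap (𝟙 Y) (adj.counit : _ ⟶ regular B.carrier) ≫ rmul Y

/-- Surjectivity of `X ⊗_A A ⟶ X`: sums of elements `x a` exhaust `X`. This makes up for the missing
unit element. -/
theorem Bimodule.RightFirm.induction {R : Type u} [NonUnitalRing R] {X : Bimodule R A.carrier}
    (hX : RightFirm X) {p : X.carrier → Prop} (x : X.carrier) (ract : ∀ a x, p (X.ract a x))
    (add : ∀ x y, p x → p y → p (x + y)) : p x := by
  obtain ⟨t, rfl⟩ := hX.2 x
  induction t using tensor_induction with
  | htmul x a => exact ract a x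
  | hadd s t hs ht => rw [map_add]; exact add _ _ hs ht

/-- The inverse of `x ⊗ a ↦ x a` is explicit only on elements `x a`, and by firmness these suffice.
-/
theorem rightUnit_ract (adj : Bicategory.Adjunction M N) {R : Type u} [NonUnitalRing R]
    {X : Bimodule R A.carrier} (hX : RightFirm X) (a : A.carrier) (x : X.carrier) :
    (rightUnit adj hX).toHom (X.ract a x) =
      (assocInv X M.bimod N.bimod).toHom
        (tmul X _ x ((adj.unit : regular A.carrier ⟶ tensorObj M.bimod N.bimod).toHom a)) := by
  have h : (rmulIso X hX).inv.toHom (X.ract a x) = tmul X (regular A.carrier) x a :=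
    congrArg (fun q : tensorObj X (regular A.carrier) ⟶ tensorObj X (regular A.carrier) =>
      q.toHom (tmul X _ x a)) (rmulIso X hX).hom_inv_id
  rw [rightUnit, comp_toHom, h]
  rfl

theorem rightUnit_naturality (adj : Bicategory.Adjunction M N) {R : Type u} [NonUnitalRing R]
    {X Y : Bimodule R A.carrier} (hX : RightFirm X) (hY : RightFirm Y) (s : X ⟶ Y) :
    s ≫ rightUnit adj hY =
      rightUnit adj hX ≫ tensorMap (tensorMap s (𝟙 M.bimod)) (𝟙 N.bimod) := by
  refine hom_ext fun x => ?_
  induction x using hX.induction with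
  | ract a x =>
    rw [comp_toHom, comp_toHom, s.map_ract, rightUnit_ract, rightUnit_ract]
    generalize (adj.unit : regular A.carrier ⟶ tensorObj M.bimod N.bimod).toHom a = t
    induction t using tensor_induction with
    | htmul m n => rfl
    | hadd t t' ht ht' => rw [tmul_add, tmul_add, map_add, map_add, map_add, ht, ht']
  | add x y hx hy => rw [map_add, map_add, hx, hy]

theorem rightCounit_naturality (adj : Bicategory.Adjunction M N) {R : Type u} [NonUnitalRing R]
    {X Y : Bimodule R B.carrier} (s : X ⟶ Y) :
    tensorMap (tensorMap s (𝟙 N.bimod)) (𝟙 M.bimod) ≫ rightCounit adj Y =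
      rightCounit adj X ≫ s :=
  tensor_hom_ext₃ fun _ _ _ => (s.map_ract _ _).symm

theorem right_triangle_tensorMap (adj : Bicategory.Adjunction M N) {R : Type u} [NonUnitalRing R]
    {X : Bimodule R A.carrier} (hX : RightFirm X) :
    tensorMap (rightUnit adj hX) (𝟙 M.bimod) ≫ rightCounit adj (tensorObj X M.bimod) = 𝟙 _ := by
  refine tensor_hom_ext fun x m => ?_
  rw [comp_toHom, tensorMap_tmul, id_toHom, id_toHom]
  induction x using hX.induction with
  | ract a x =>
    rw [rightUnit_ract]
    -- Both sides are additive in `t`, so pure tensors suffice. At `t = η(a)` the right-hand side is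
    -- evaluated by the triangle identity, in the form `xiRight_unit`.
    have key : ∀ t : (tensorObj M.bimod N.bimod).carrier,
        (rightCounit adj (tensorObj X M.bimod)).toHom
          (tmul _ M.bimod ((assocInv X M.bimod N.bimod).toHom (tmul X _ x t)) m) =
        tmul X M.bimod x ((assocHom M.bimod N.bimod M.bimod ≫
          tensorMap (𝟙 _) (adj.counit : _ ⟶ regular B.carrier) ≫ rmul M.bimod).toHom
            (tmul _ M.bimod t m)) := fun t => by
      induction t using tensor_induction with
      | htmul m n => rfl
      | hadd t t' ht ht' =>
        rw [tmul_add, map_add, add_tmul, map_add, ht, ht', add_tmul, map_add, tmul_add]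
    rw [key, ract_tmul]
    exact congrArg (tmul X M.bimod x) (congrArg (fun q : tensorObj (regular A.carrier) M.bimod ⟶
      M.bimod => q.toHom (tmul _ _ a m)) (xiRight_unit adj))
  | add x y hx hy => rw [map_add, add_tmul, map_add, hx, hy, add_tmul]

theorem rightUnit_tensorMap_rightCounit (adj : Bicategory.Adjunction M N) {R : Type u}
    [NonUnitalRing R] (Y : Bimodule R B.carrier) :
    rightUnit adj (RightFirm.tensorObj Y N.rightFirm) ≫
      tensorMap (rightCounit adj Y) (𝟙 N.bimod) = 𝟙 _ := by
  refine tensor_hom_ext fun y n => ?_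
  rw [comp_toHom, id_toHom]
  induction n using (RightFirm.induction N.rightFirm) with
  | ract a n =>
    rw [← tensorObj_ract, rightUnit_ract]
    have key : ∀ t : (tensorObj M.bimod N.bimod).carrier,
        (tensorMap (rightCounit adj Y) (𝟙 N.bimod)).toHom
          ((assocInv _ M.bimod N.bimod).toHom (tmul _ _ (tmul Y N.bimod y n) t)) =
        tmul Y N.bimod y ((assocInv N.bimod M.bimod N.bimod ≫
          tensorMap (adj.counit : _ ⟶ regular B.carrier) (𝟙 _) ≫ lmul N.bimod).toHom
            (tmul N.bimod _ n t)) := fun t => by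
      induction t using tensor_induction with
      | htmul m n => exact ract_tmul _ _ _
      | hadd t t' ht ht' =>
        rw [tmul_add, map_add, map_add, ht, ht', tmul_add, map_add, tmul_add]
    rw [key, tensorObj_ract]
    exact congrArg (tmul Y N.bimod y) (congrArg (fun q : tensorObj N.bimod (regular A.carrier) ⟶
      N.bimod => q.toHom (tmul _ _ n a)) (xiLeft_unit adj))
  | add x y hx hy => rw [tmul_add, map_add, map_add, hx, hy]

/-- The adjunction `- ⊗_A M ⊣ - ⊗_B N` between categories of firm right modules. -/
noncomputable def tensorRightAdj (adj : Bicategory.Adjunction M N) :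
    tensorRightFunctor M ⊣ tensorRightFunctor N :=
  -- Firm right modules are not 1-cells here, since a firm left module over the zero ring is zero.
  -- So `postcompAdj` does not apply, and the adjunction is checked on elements.
  CategoryTheory.Adjunction.mkOfUnitCounit
    { unit := { app := fun X => rightUnit adj X.firm
                naturality := fun X Y s => rightUnit_naturality adj X.firm Y.firm s }
      counit := { app := fun Y => rightCounit adj Y.module
                  naturality := fun X Y s => rightCounit_naturality adj s }
      left_triangle := by
        ext X
        exact congrArg (_ ≫ ·) (Category.id_comp _) |>.trans (right_triangle_tensorMap adj X.firm)
      right_triangle := by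
        ext Y
        exact congrArg (_ ≫ ·) (Category.id_comp _) |>.trans
          (rightUnit_tensorMap_rightCounit adj Y.module) }

/-! ### Forgetting the left action -/

/-- A homomorphism of right modules. -/
def mkRightHom {A : Type u} [NonUnitalRing A] {X Y : Bimodule PUnit.{u + 1} A}
    (φ : X.carrier →+ Y.carrier) (h : ∀ a x, φ (X.ract a x) = Y.ract a (φ x)) : X ⟶ Y :=
  Hom.mk φ (fun a x => by
    rw [Subsingleton.elim a 0, map_zero, map_zero]
    exact map_zero φ) h

/-- The right module underlying a bimodule. -/
def forgetLeft {C A : Type u} [NonUnitalRing C] [NonUnitalRing A] (X : Bimodule C A) :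
    Bimodule PUnit.{u + 1} A where
  carrier := X.carrier
  lact := 0
  ract := X.ract
  lact_mul _ _ _ := rfl
  ract_mul := X.ract_mul
  lact_ract _ _ _ := (map_zero _).symm

/-- The firm right module underlying a bimodule which is firm on the right. -/
def toRightModule {C : Type u} [NonUnitalRing C] (X : Bimodule C A.carrier) (hX : RightFirm X) :
    FirmRightModule A :=
  ⟨forgetLeft X, hX⟩

/-- The homomorphism of right modules underlying a homomorphism of bimodules. -/
def toRightHom {C : Type u} [NonUnitalRing C] {X Y : Bimodule C A.carrier} (hX : RightFirm X)
    (hY : RightFirm Y) (s : X ⟶ Y) : toRightModule X hX ⟶ toRightModule Y hY :=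
  mkRightHom (X := forgetLeft X) (Y := forgetLeft Y) s.toHom s.map_ract

theorem right_hom_ext {X Y : FirmRightModule A} {s t : X ⟶ Y}
    (h : ∀ x, s.toHom x = t.toHom x) : s = t :=
  Bimodule.hom_ext (M := X.module) (N := Y.module) h

/-- A bijective homomorphism of firm right modules is an isomorphism. -/
theorem isIso_of_bijective_right {X Y : FirmRightModule A} (s : X ⟶ Y)
    (hs : Function.Bijective s.toHom) : IsIso s :=
  ⟨(isoOfBijective (M := X.module) (N := Y.module) s hs).inv,
    (isoOfBijective (M := X.module) (N := Y.module) s hs).hom_inv_id,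
    (isoOfBijective (M := X.module) (N := Y.module) s hs).inv_hom_id⟩

theorem bijective_of_isIso_right {X Y : FirmRightModule A} (s : X ⟶ Y) [IsIso s] :
    Function.Bijective s.toHom := by
  obtain ⟨t, h, h'⟩ := IsIso.out (f := s)
  exact bijective_of_iso (M := X.module) (N := Y.module) ⟨s, t, h, h'⟩

/-- The left action of `c` on a bimodule, as an endomorphism of its right module. -/
def lactRight {C : Type u} [NonUnitalRing C] {X : Bimodule C A.carrier} (hX : RightFirm X)
    (c : C) : toRightModule X hX ⟶ toRightModule X hX :=
  mkRightHom (X := forgetLeft X) (Y := forgetLeft X) (X.lact c) fun a x => X.lact_ract c a x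

/-- Left multiplication by an element of `C` is an endomorphism of the underlying right module, so a
left action can be descended by means of faithfulness and fullness for right modules. -/
theorem effectiveDescent_postcompAdj (adj : Bicategory.Adjunction M N)
    (h : EffectiveDescent (tensorRightAdj adj)) (C : FirmRing.{u}) :
    EffectiveDescent (postcompAdj adj C) where
  faithful {X Y s t} hst := by
    have h₁ : toRightHom X.rightFirm Y.rightFirm s = toRightHom X.rightFirm Y.rightFirm t :=
      h.faithful <| tensor_hom_ext fun x m =>
        congrArg (fun q : tensorObj X.bimod M.bimod ⟶ tensorObj Y.bimod M.bimod =>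
          q.toHom (tmul X.bimod M.bimod x m)) hst
    exact Bimodule.hom_ext fun x => congrArg (fun q => q.toHom x) h₁
  full {X Y} θ hθ := by
    obtain ⟨t, ht⟩ := h.full (X := toRightModule X.bimod X.rightFirm)
      (Y := toRightModule Y.bimod Y.rightFirm)
      (mkRightHom (X := tensorObj (forgetLeft X.bimod) M.bimod)
        (Y := tensorObj (forgetLeft Y.bimod) M.bimod) θ.toHom θ.map_ract)
      (right_hom_ext fun x => congrArg (fun q => q.toHom x) hθ)
    have ht' : ∀ x m, tmul Y.bimod M.bimod (t.toHom x) m = θ.toHom (tmul X.bimod M.bimod x m) :=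
      fun x m => congrArg (fun q => q.toHom (tmul (forgetLeft X.bimod) M.bimod x m)) ht
    have hl : ∀ c, lactRight X.rightFirm c ≫ t = t ≫ lactRight Y.rightFirm c := fun c =>
      h.faithful <| tensor_hom_ext fun x m =>
        (ht' (X.bimod.lact c x) m).trans <|
          (θ.map_lact c (tmul X.bimod M.bimod x m)).trans
            (congrArg ((tensorObj Y.bimod M.bimod).lact c) (ht' x m).symm)
    exact ⟨Bimodule.Hom.mk t.toHom (fun c x => congrArg (fun q => q.toHom x) (hl c)) t.map_ract,
      tensor_hom_ext ht'⟩
  essSurj {Y} y h₁ h₂ := by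
    let Y' := toRightModule Y.bimod Y.rightFirm
    let F := tensorRightFunctor M
    let G := tensorRightFunctor N
    let y' : Y' ⟶ F.obj (G.obj Y') :=
      mkRightHom (X := forgetLeft Y.bimod)
        (Y := tensorObj (tensorObj (forgetLeft Y.bimod) N.bimod) M.bimod) y.toHom y.map_ract
    obtain ⟨X, e, he⟩ := h.essSurj y' (right_hom_ext fun x => congrArg (fun q => q.toHom x) h₁)
      (right_hom_ext fun x => congrArg (fun q => q.toHom x) h₂)
    -- Since `y` is left linear, each left multiplication is an endomorphism of the coalgebra `Y`.
    have hl : ∀ c, lactRight Y.rightFirm c ≫ y' =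
        y' ≫ F.map (G.map (lactRight Y.rightFirm c)) := fun c =>
      right_hom_ext fun x => (y.map_lact c x).trans <| by
        have : ∀ t : (tensorObj (tensorObj Y.bimod N.bimod) M.bimod).carrier,
            (tensorObj (tensorObj Y.bimod N.bimod) M.bimod).lact c t =
              (F.map (G.map (lactRight Y.rightFirm c))).toHom t := fun t => rfl
        exact this _
    -- Conjugated by `e`, left multiplication by `c` is an endomorphism of the coalgebra `F X`,
    -- hence descends. The descended maps are the left action on `X`.
    have hk : ∀ c, ∃ t : X ⟶ X, F.map t = e.hom ≫ lactRight Y.rightFirm c ≫ e.inv := fun c =>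
      h.full _ (by
        have he' : y' ≫ F.map (G.map e.inv) =
            e.inv ≫ F.map ((tensorRightAdj adj).unit.app X) := by
          rw [Iso.eq_inv_comp, ← Category.assoc, ← he, Category.assoc, ← F.map_comp, ← G.map_comp]
          simp [F, G]
        have he'' : F.map ((tensorRightAdj adj).unit.app X) ≫ F.map (G.map e.hom) = e.hom ≫ y' := he
        change _ ≫ F.map (G.map _) = _ ≫ F.map _
        rw [G.map_comp, G.map_comp, F.map_comp, F.map_comp, ← Category.assoc, he'', Category.assoc,
          ← Category.assoc y', ← hl c, Category.assoc, he']
        simp only [Category.assoc])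
    choose t ht using hk
    have ht' : ∀ c x m, e.hom.toHom (tmul X.module M.bimod ((t c).toHom x) m) =
        Y.bimod.lact c (e.hom.toHom (tmul X.module M.bimod x m)) := fun c x m => by
      have h₃ : F.map (t c) ≫ e.hom = e.hom ≫ lactRight Y.rightFirm c := by
        rw [ht]; simp
      exact congrArg (fun q => q.toHom (tmul X.module M.bimod x m)) h₃
    have einj : Function.Injective e.hom.toHom := (bijective_of_isIso_right e.hom).1
    -- The identities of an action hold for `t` because they hold on `Y`: tensoring with `M` is
    -- faithful and `e` is injective.
    have hext : ∀ {s s' : X ⟶ X}, (∀ x m, e.hom.toHom (tmul X.module M.bimod (s.toHom x) m) =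
        e.hom.toHom (tmul X.module M.bimod (s'.toHom x) m)) → s = s' := fun hs =>
      h.faithful <| tensor_hom_ext fun x m => einj (hs x m)
    let lact : C.carrier →+ X.module.carrier →+ X.module.carrier :=
      AddMonoidHom.mk' (fun c => (t c).toHom) fun c c' => by
        let s : X ⟶ X := Bimodule.Hom.mk ((t c).toHom + (t c').toHom)
          (fun a x => by simp [(t c).map_lact, (t c').map_lact])
          (fun a x => by simp [(t c).map_ract, (t c').map_ract])
        have : t (c + c') = s := hext fun x m => by
          rw [ht', map_add]
          change _ = e.hom.toHom (tmul X.module M.bimod ((t c).toHom x + (t c').toHom x) m)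
          rw [add_tmul]
          exact ((congrArg₂ (· + ·) (ht' c x m) (ht' c' x m)).symm).trans
            (map_add e.hom.toHom _ _).symm
        exact congrArg (fun q => q.toHom) this
    let J : Bimodule C.carrier A.carrier :=
      { carrier := X.module.carrier
        lact := lact
        ract := X.module.ract
        lact_mul := fun c c' x => by
          have : t (c * c') = t c' ≫ t c := hext fun x m =>
            (ht' (c * c') x m).trans <| (Y.bimod.lact_mul c c' _).trans <|
              (congrArg (Y.bimod.lact c) (ht' c' x m).symm).trans
                (ht' c ((t c').toHom x) m).symm
          exact congrArg (fun q => q.toHom x) this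
        ract_mul := X.module.ract_mul
        lact_ract := fun c a x => (t c).map_ract a x }
    have hJr : RightFirm J := X.firm
    let E : tensorObj J M.bimod ≅ Y.bimod :=
      isoOfBijective (M := tensorObj J M.bimod) (N := Y.bimod)
        (Bimodule.Hom.mk e.hom.toHom (fun c z => by
          induction z using tensor_induction with
          | htmul x m => exact ht' c x m
          | hadd z z' hz hz' =>
            rw [map_add]
            exact (map_add e.hom.toHom _ _).trans ((congrArg₂ (· + ·) hz hz').trans
              ((map_add (Y.bimod.lact c) _ _).symm.trans
                (congrArg (Y.bimod.lact c) (map_add e.hom.toHom z z').symm))))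
          e.hom.map_ract)
        (bijective_of_isIso_right e.hom)
    have hTJ : LeftFirm (tensorObj J M.bimod) :=
      Y.leftFirm.of_retract E.hom E.inv E.hom_inv_id
    -- After tensoring with `M`, the map `C ⊗ J ⟶ J` becomes the multiplication map of `J ⊗ M ≅ Y`,
    -- which is left firm; and `- ⊗_A M` reflects isomorphisms.
    have hJl : LeftFirm J := by
      have hb : Function.Bijective (tensorMap (lmul J) (𝟙 M.bimod)).toHom := by
        have : tensorMap (lmul J) (𝟙 M.bimod) = (assocIso (regular C.carrier) J M.bimod ≪≫
            isoOfBijective (lmul (tensorObj J M.bimod)) hTJ).hom :=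
          tensor_hom_ext₃ fun _ _ _ => rfl
        rw [this]
        exact bijective_of_iso _
      let l := toRightHom (RightFirm.tensorObj (regular C.carrier) hJr) hJr (lmul J)
      have : IsIso ((tensorRightFunctor M).map l) := isIso_of_bijective_right _ hb
      have : IsIso l := h.isIso_of_isIso_map l
      exact bijective_of_isIso_right l
    exact ⟨⟨J, hJl, hJr⟩, FirmBimodule.mkIso E,
      Bimodule.hom_ext fun z => congrArg (fun q => q.toHom z) he⟩

theorem gammaRightIsMonoidIso_of_isComonadic (adj : Bicategory.Adjunction M N)
    (h : IsComonadic (tensorRightFunctor M)) : GammaRightIsMonoidIso adj := by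
  obtain ⟨U, adj', _⟩ := h
  -- Comonadicity provides an arbitrary right adjoint `U`, which is exchanged for `- ⊗_B N`.
  exact gammaRightIsMonoidIso_of_effectiveDescent adj (effectiveDescent_postcompAdj adj
    ((effectiveDescent_of_comparison adj').of_adjunction (tensorRightAdj adj)) A)

end RightModules

/-! ### The adjunction `N ⊗_A - ⊣ M ⊗_B -` between categories of firm left modules -/

section LeftModules

variable {A B : FirmRing.{u}} {M : A ⟶ B} {N : B ⟶ A}

/-- The map `X ⟶ M ⊗_B N ⊗_A X` given by the unit of an adjunction. -/
noncomputable def leftUnit (adj : Bicategory.Adjunction M N) {R : Type u} [NonUnitalRing R]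
    {X : Bimodule A.carrier R} (hX : LeftFirm X) :
    X ⟶ tensorObj M.bimod (tensorObj N.bimod X) :=
  (lmulIso X hX).inv ≫ tensorMap (adj.unit : regular A.carrier ⟶ _) (𝟙 X) ≫ assocHom _ _ _

/-- The map `N ⊗_A M ⊗_B Y ⟶ Y` given by the counit of an adjunction. -/
noncomputable def leftCounit (adj : Bicategory.Adjunction M N) {R : Type u} [NonUnitalRing R]
    (Y : Bimodule B.carrier R) : tensorObj N.bimod (tensorObj M.bimod Y) ⟶ Y :=
  assocInv _ _ _ ≫ tensorMap (adj.counit : _ ⟶ regular B.carrier) (𝟙 Y) ≫ lmul Y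

theorem Bimodule.LeftFirm.induction {R : Type u} [NonUnitalRing R] {X : Bimodule A.carrier R}
    (hX : LeftFirm X) {p : X.carrier → Prop} (x : X.carrier) (lact : ∀ a x, p (X.lact a x))
    (add : ∀ x y, p x → p y → p (x + y)) : p x := by
  obtain ⟨t, rfl⟩ := hX.2 x
  induction t using tensor_induction with
  | htmul a x => exact lact a x
  | hadd s t hs ht => rw [map_add]; exact add _ _ hs ht

theorem leftUnit_lact (adj : Bicategory.Adjunction M N) {R : Type u} [NonUnitalRing R]
    {X : Bimodule A.carrier R} (hX : LeftFirm X) (a : A.carrier) (x : X.carrier) :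
    (leftUnit adj hX).toHom (X.lact a x) =
      (assocHom M.bimod N.bimod X).toHom
        (tmul _ X ((adj.unit : regular A.carrier ⟶ tensorObj M.bimod N.bimod).toHom a) x) := by
  have h : (lmulIso X hX).inv.toHom (X.lact a x) = tmul (regular A.carrier) X a x :=
    congrArg (fun q : tensorObj (regular A.carrier) X ⟶ tensorObj (regular A.carrier) X =>
      q.toHom (tmul _ X a x)) (lmulIso X hX).hom_inv_id
  rw [leftUnit, comp_toHom, h]
  rfl

theorem leftUnit_naturality (adj : Bicategory.Adjunction M N) {R : Type u} [NonUnitalRing R]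
    {X Y : Bimodule A.carrier R} (hX : LeftFirm X) (hY : LeftFirm Y) (s : X ⟶ Y) :
    s ≫ leftUnit adj hY =
      leftUnit adj hX ≫ tensorMap (𝟙 M.bimod) (tensorMap (𝟙 N.bimod) s) := by
  refine hom_ext fun x => ?_
  induction x using hX.induction with
  | lact a x =>
    rw [comp_toHom, comp_toHom, s.map_lact, leftUnit_lact, leftUnit_lact]
    generalize (adj.unit : regular A.carrier ⟶ tensorObj M.bimod N.bimod).toHom a = t
    induction t using tensor_induction with
    | htmul m n => rfl
    | hadd t t' ht ht' => rw [add_tmul, add_tmul, map_add, map_add, map_add, ht, ht']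
  | add x y hx hy => rw [map_add, map_add, hx, hy]

theorem leftCounit_naturality (adj : Bicategory.Adjunction M N) {R : Type u} [NonUnitalRing R]
    {X Y : Bimodule B.carrier R} (s : X ⟶ Y) :
    tensorMap (𝟙 N.bimod) (tensorMap (𝟙 M.bimod) s) ≫ leftCounit adj Y =
      leftCounit adj X ≫ s :=
  tensor_hom_ext₃' fun _ _ _ => (s.map_lact _ _).symm

theorem left_triangle_tensorMap (adj : Bicategory.Adjunction M N) {R : Type u} [NonUnitalRing R]
    {X : Bimodule A.carrier R} (hX : LeftFirm X) :
    tensorMap (𝟙 N.bimod) (leftUnit adj hX) ≫ leftCounit adj (tensorObj N.bimod X) = 𝟙 _ := by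
  refine tensor_hom_ext fun n x => ?_
  rw [comp_toHom, tensorMap_tmul, id_toHom, id_toHom]
  induction x using hX.induction with
  | lact a x =>
    rw [leftUnit_lact]
    have key : ∀ t : (tensorObj M.bimod N.bimod).carrier,
        (leftCounit adj (tensorObj N.bimod X)).toHom
          (tmul N.bimod _ n ((assocHom M.bimod N.bimod X).toHom (tmul _ X t x))) =
        tmul N.bimod X ((assocInv N.bimod M.bimod N.bimod ≫
          tensorMap (adj.counit : _ ⟶ regular B.carrier) (𝟙 _) ≫ lmul N.bimod).toHom
            (tmul N.bimod _ n t)) x := fun t => by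
      induction t using tensor_induction with
      | htmul m n => rfl
      | hadd t t' ht ht' =>
        rw [add_tmul, map_add, tmul_add, map_add, ht, ht', tmul_add, map_add, add_tmul]
    rw [key, ← ract_tmul]
    exact congrArg (fun n => tmul N.bimod X n x) (congrArg (fun q : tensorObj N.bimod
      (regular A.carrier) ⟶ N.bimod => q.toHom (tmul _ _ n a)) (xiLeft_unit adj))
  | add x y hx hy => rw [map_add, tmul_add, map_add, hx, hy, tmul_add]

theorem leftUnit_tensorMap_leftCounit (adj : Bicategory.Adjunction M N) {R : Type u}
    [NonUnitalRing R] (Y : Bimodule B.carrier R) :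
    leftUnit adj (LeftFirm.tensorObj M.leftFirm Y) ≫
      tensorMap (𝟙 M.bimod) (leftCounit adj Y) = 𝟙 _ := by
  refine tensor_hom_ext fun m y => ?_
  rw [comp_toHom, id_toHom]
  induction m using (LeftFirm.induction M.leftFirm) with
  | lact a m =>
    rw [← tensorObj_lact, leftUnit_lact]
    have key : ∀ t : (tensorObj M.bimod N.bimod).carrier,
        (tensorMap (𝟙 M.bimod) (leftCounit adj Y)).toHom
          ((assocHom M.bimod N.bimod _).toHom (tmul _ _ t (tmul M.bimod Y m y))) =
        tmul M.bimod Y ((assocHom M.bimod N.bimod M.bimod ≫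
          tensorMap (𝟙 _) (adj.counit : _ ⟶ regular B.carrier) ≫ rmul M.bimod).toHom
            (tmul _ M.bimod t m)) y := fun t => by
      induction t using tensor_induction with
      | htmul m n => exact (ract_tmul _ _ _).symm
      | hadd t t' ht ht' =>
        rw [add_tmul, map_add, map_add, ht, ht', add_tmul, map_add, add_tmul]
    rw [key, tensorObj_lact]
    exact congrArg (fun m => tmul M.bimod Y m y) (congrArg (fun q : tensorObj
      (regular A.carrier) M.bimod ⟶ M.bimod => q.toHom (tmul _ _ a m)) (xiRight_unit adj))
  | add x y hx hy => rw [add_tmul, map_add, map_add, hx, hy]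

/-- The adjunction `N ⊗_A - ⊣ M ⊗_B -` between categories of firm left modules. -/
noncomputable def tensorLeftAdj (adj : Bicategory.Adjunction M N) :
    tensorLeftFunctor N ⊣ tensorLeftFunctor M :=
  CategoryTheory.Adjunction.mkOfUnitCounit
    { unit := { app := fun X => leftUnit adj X.firm
                naturality := fun X Y s => leftUnit_naturality adj X.firm Y.firm s }
      counit := { app := fun Y => leftCounit adj Y.module
                  naturality := fun X Y s => leftCounit_naturality adj s }
      left_triangle := by
        ext X
        exact congrArg (_ ≫ ·) (Category.id_comp _) |>.trans (left_triangle_tensorMap adj X.firm)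
      right_triangle := by
        ext Y
        exact congrArg (_ ≫ ·) (Category.id_comp _) |>.trans
          (leftUnit_tensorMap_leftCounit adj Y.module) }

/-! ### Forgetting the right action -/

/-- A homomorphism of left modules. -/
def mkLeftHom {A : Type u} [NonUnitalRing A] {X Y : Bimodule A PUnit.{u + 1}}
    (φ : X.carrier →+ Y.carrier) (h : ∀ a x, φ (X.lact a x) = Y.lact a (φ x)) : X ⟶ Y :=
  Hom.mk φ h fun a x => by
    rw [Subsingleton.elim a 0, map_zero, map_zero]
    exact map_zero φ

/-- The left module underlying a bimodule. -/
def forgetRight {A C : Type u} [NonUnitalRing A] [NonUnitalRing C] (X : Bimodule A C) :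
    Bimodule A PUnit.{u + 1} where
  carrier := X.carrier
  lact := X.lact
  ract := 0
  lact_mul := X.lact_mul
  ract_mul _ _ _ := rfl
  lact_ract _ _ _ := map_zero _

/-- The firm left module underlying a bimodule which is firm on the left. -/
def toLeftModule {C : Type u} [NonUnitalRing C] (X : Bimodule A.carrier C) (hX : LeftFirm X) :
    FirmLeftModule A :=
  ⟨forgetRight X, hX⟩

/-- The homomorphism of left modules underlying a homomorphism of bimodules. -/
def toLeftHom {C : Type u} [NonUnitalRing C] {X Y : Bimodule A.carrier C} (hX : LeftFirm X)
    (hY : LeftFirm Y) (s : X ⟶ Y) : toLeftModule X hX ⟶ toLeftModule Y hY :=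
  mkLeftHom (X := forgetRight X) (Y := forgetRight Y) s.toHom s.map_lact

theorem left_hom_ext {X Y : FirmLeftModule A} {s t : X ⟶ Y}
    (h : ∀ x, s.toHom x = t.toHom x) : s = t :=
  Bimodule.hom_ext (M := X.module) (N := Y.module) h

/-- A bijective homomorphism of firm left modules is an isomorphism. -/
theorem isIso_of_bijective_left {X Y : FirmLeftModule A} (s : X ⟶ Y)
    (hs : Function.Bijective s.toHom) : IsIso s :=
  ⟨(isoOfBijective (M := X.module) (N := Y.module) s hs).inv,
    (isoOfBijective (M := X.module) (N := Y.module) s hs).hom_inv_id,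
    (isoOfBijective (M := X.module) (N := Y.module) s hs).inv_hom_id⟩

theorem bijective_of_isIso_left {X Y : FirmLeftModule A} (s : X ⟶ Y) [IsIso s] :
    Function.Bijective s.toHom := by
  obtain ⟨t, h, h'⟩ := IsIso.out (f := s)
  exact bijective_of_iso (M := X.module) (N := Y.module) ⟨s, t, h, h'⟩

/-- The right action of `c` on a bimodule, as an endomorphism of its left module. -/
def ractLeft {C : Type u} [NonUnitalRing C] {X : Bimodule A.carrier C} (hX : LeftFirm X)
    (c : C) : toLeftModule X hX ⟶ toLeftModule X hX :=
  mkLeftHom (X := forgetRight X) (Y := forgetRight X) (X.ract c)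
    fun a x => (X.lact_ract a c x).symm

/-- The mirror argument: right multiplications by elements of `C` are endomorphisms of the
underlying left module, and they descend along `N ⊗_A -`. -/
theorem effectiveDescent_precompAdj (adj : Bicategory.Adjunction M N)
    (h : EffectiveDescent (tensorLeftAdj adj)) (C : FirmRing.{u}) :
    EffectiveDescent (precompAdj adj C) where
  faithful {X Y s t} hst := by
    have h₁ : toLeftHom X.leftFirm Y.leftFirm s = toLeftHom X.leftFirm Y.leftFirm t :=
      h.faithful <| tensor_hom_ext fun n x =>
        congrArg (fun q : tensorObj N.bimod X.bimod ⟶ tensorObj N.bimod Y.bimod =>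
          q.toHom (tmul N.bimod X.bimod n x)) hst
    exact Bimodule.hom_ext fun x => congrArg (fun q => q.toHom x) h₁
  full {X Y} θ hθ := by
    obtain ⟨t, ht⟩ := h.full (X := toLeftModule X.bimod X.leftFirm)
      (Y := toLeftModule Y.bimod Y.leftFirm)
      (mkLeftHom (X := tensorObj N.bimod (forgetRight X.bimod))
        (Y := tensorObj N.bimod (forgetRight Y.bimod)) θ.toHom θ.map_lact)
      (left_hom_ext fun x => congrArg (fun q => q.toHom x) hθ)
    have ht' : ∀ n x, tmul N.bimod Y.bimod n (t.toHom x) = θ.toHom (tmul N.bimod X.bimod n x) :=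
      fun n x => congrArg (fun q => q.toHom (tmul N.bimod (forgetRight X.bimod) n x)) ht
    have hl : ∀ c, ractLeft X.leftFirm c ≫ t = t ≫ ractLeft Y.leftFirm c := fun c =>
      h.faithful <| tensor_hom_ext fun n x =>
        (ht' n (X.bimod.ract c x)).trans <|
          (θ.map_ract c (tmul N.bimod X.bimod n x)).trans
            (congrArg ((tensorObj N.bimod Y.bimod).ract c) (ht' n x).symm)
    exact ⟨Bimodule.Hom.mk t.toHom t.map_lact (fun c x => congrArg (fun q => q.toHom x) (hl c)),
      tensor_hom_ext ht'⟩
  essSurj {Y} y h₁ h₂ := by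
    let Y' := toLeftModule Y.bimod Y.leftFirm
    let F := tensorLeftFunctor N
    let G := tensorLeftFunctor M
    let y' : Y' ⟶ F.obj (G.obj Y') :=
      mkLeftHom (X := forgetRight Y.bimod)
        (Y := tensorObj N.bimod (tensorObj M.bimod (forgetRight Y.bimod))) y.toHom y.map_lact
    obtain ⟨X, e, he⟩ := h.essSurj y' (left_hom_ext fun x => congrArg (fun q => q.toHom x) h₁)
      (left_hom_ext fun x => congrArg (fun q => q.toHom x) h₂)
    have hl : ∀ c, ractLeft Y.leftFirm c ≫ y' =
        y' ≫ F.map (G.map (ractLeft Y.leftFirm c)) := fun c =>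
      left_hom_ext fun x => (y.map_ract c x).trans <| by
        have : ∀ t : (tensorObj N.bimod (tensorObj M.bimod Y.bimod)).carrier,
            (tensorObj N.bimod (tensorObj M.bimod Y.bimod)).ract c t =
              (F.map (G.map (ractLeft Y.leftFirm c))).toHom t := fun t => rfl
        exact this _
    have hk : ∀ c, ∃ t : X ⟶ X, F.map t = e.hom ≫ ractLeft Y.leftFirm c ≫ e.inv := fun c =>
      h.full _ (by
        have he' : y' ≫ F.map (G.map e.inv) =
            e.inv ≫ F.map ((tensorLeftAdj adj).unit.app X) := by
          rw [Iso.eq_inv_comp, ← Category.assoc, ← he, Category.assoc, ← F.map_comp, ← G.map_comp]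
          simp [F, G]
        have he'' : F.map ((tensorLeftAdj adj).unit.app X) ≫ F.map (G.map e.hom) = e.hom ≫ y' := he
        change _ ≫ F.map (G.map _) = _ ≫ F.map _
        rw [G.map_comp, G.map_comp, F.map_comp, F.map_comp, ← Category.assoc, he'', Category.assoc,
          ← Category.assoc y', ← hl c, Category.assoc, he']
        simp only [Category.assoc])
    choose t ht using hk
    have ht' : ∀ c n x, e.hom.toHom (tmul N.bimod X.module n ((t c).toHom x)) =
        Y.bimod.ract c (e.hom.toHom (tmul N.bimod X.module n x)) := fun c n x => by
      have h₃ : F.map (t c) ≫ e.hom = e.hom ≫ ractLeft Y.leftFirm c := by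
        rw [ht]; simp
      exact congrArg (fun q => q.toHom (tmul N.bimod X.module n x)) h₃
    have einj : Function.Injective e.hom.toHom := (bijective_of_isIso_left e.hom).1
    have hext : ∀ {s s' : X ⟶ X}, (∀ n x, e.hom.toHom (tmul N.bimod X.module n (s.toHom x)) =
        e.hom.toHom (tmul N.bimod X.module n (s'.toHom x))) → s = s' := fun hs =>
      h.faithful <| tensor_hom_ext fun n x => einj (hs n x)
    let ract : C.carrier →+ X.module.carrier →+ X.module.carrier :=
      AddMonoidHom.mk' (fun c => (t c).toHom) fun c c' => by
        let s : X ⟶ X := Bimodule.Hom.mk ((t c).toHom + (t c').toHom)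
          (fun a x => by simp [(t c).map_lact, (t c').map_lact])
          (fun a x => by simp [(t c).map_ract, (t c').map_ract])
        have : t (c + c') = s := hext fun n x => by
          rw [ht', map_add]
          change _ = e.hom.toHom (tmul N.bimod X.module n ((t c).toHom x + (t c').toHom x))
          rw [tmul_add]
          exact ((congrArg₂ (· + ·) (ht' c n x) (ht' c' n x)).symm).trans
            (map_add e.hom.toHom _ _).symm
        exact congrArg (fun q => q.toHom) this
    let J : Bimodule A.carrier C.carrier :=
      { carrier := X.module.carrier
        lact := X.module.lact
        ract := ract
        lact_mul := X.module.lact_mul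
        ract_mul := fun c c' x => by
          -- For a right action `c` acts first, so the order is opposite to that for left actions.
          have : t (c * c') = t c ≫ t c' := hext fun n x =>
            (ht' (c * c') n x).trans <| (Y.bimod.ract_mul c c' _).trans <|
              (congrArg (Y.bimod.ract c') (ht' c n x).symm).trans
                (ht' c' n ((t c).toHom x)).symm
          exact congrArg (fun q => q.toHom x) this
        lact_ract := fun a c x => ((t c).map_lact a x).symm }
    have hJl : LeftFirm J := X.firm
    let E : tensorObj N.bimod J ≅ Y.bimod :=
      isoOfBijective (M := tensorObj N.bimod J) (N := Y.bimod)
        (Bimodule.Hom.mk e.hom.toHom e.hom.map_lact (fun c z => by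
          induction z using tensor_induction with
          | htmul n x => exact ht' c n x
          | hadd z z' hz hz' =>
            rw [map_add]
            exact (map_add e.hom.toHom _ _).trans ((congrArg₂ (· + ·) hz hz').trans
              ((map_add (Y.bimod.ract c) _ _).symm.trans
                (congrArg (Y.bimod.ract c) (map_add e.hom.toHom z z').symm)))))
        (bijective_of_isIso_left e.hom)
    have hTJ : RightFirm (tensorObj N.bimod J) :=
      Y.rightFirm.of_retract E.hom E.inv E.hom_inv_id
    -- Tensoring `J ⊗ C ⟶ J` with `N` gives the multiplication map of `N ⊗ J ≅ Y`, which is right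
    -- firm; and `N ⊗_A -` reflects isomorphisms.
    have hJr : RightFirm J := by
      have hb : Function.Bijective (tensorMap (𝟙 N.bimod) (rmul J)).toHom := by
        have : tensorMap (𝟙 N.bimod) (rmul J) =
            ((assocIso N.bimod J (regular C.carrier)).symm ≪≫
              isoOfBijective (rmul (tensorObj N.bimod J)) hTJ).hom :=
          tensor_hom_ext₃' fun _ _ _ => rfl
        rw [this]
        exact bijective_of_iso _
      let l := toLeftHom (LeftFirm.tensorObj hJl (regular C.carrier)) hJl (rmul J)
      have : IsIso ((tensorLeftFunctor N).map l) := isIso_of_bijective_left _ hb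
      have : IsIso l := h.isIso_of_isIso_map l
      exact bijective_of_isIso_left l
    exact ⟨⟨J, hJl, hJr⟩, FirmBimodule.mkIso E,
      Bimodule.hom_ext fun z => congrArg (fun q => q.toHom z) he⟩

theorem gammaLeftIsMonoidIso_of_isComonadic (adj : Bicategory.Adjunction M N)
    (h : IsComonadic (tensorLeftFunctor N)) : GammaLeftIsMonoidIso adj := by
  obtain ⟨U, adj', _⟩ := h
  exact gammaLeftIsMonoidIso_of_effectiveDescent adj (effectiveDescent_precompAdj adj
    ((effectiveDescent_of_comparison adj').of_adjunction (tensorLeftAdj adj)) A)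

end LeftModules

end FirmBicat

theorem mainTheorem10 {A B : FirmRing.{u}} (M : A ⟶ B) (Mdag : B ⟶ A)
    (adj : Bicategory.Adjunction M Mdag) :
    (IsComonadic (tensorRightFunctor M) → GammaRightIsMonoidIso adj) ∧
    (IsComonadic (tensorLeftFunctor Mdag) → GammaLeftIsMonoidIso adj) ∧
    (IsSeparableCell adj → GammaRightIsMonoidIso adj ∧ GammaLeftIsMonoidIso adj) :=
  ⟨gammaRightIsMonoidIso_of_isComonadic adj, gammaLeftIsMonoidIso_of_isComonadic adj,
    gammaIsMonoidIso_of_isSeparableCell adj⟩
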